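/- **Contact reduction by scaling symmetries: general case.** Let $M$ be a smooth manifold of dimension $2n+2$ ($n\ge 0$), $\omega$ a symplectic form on $M$, and $H:M\to\mathbb R$ a smooth function, with Hamiltonian vector field $X_H$ defined by $i_{X_H}\omega=-dH$. Let $\Lambda\in\mathbb R$, $\Lambda\neq 0$, and let $D$ be a scaling symmetry of degree $\Lambda$, i.e. a smooth vector field on $M$ with $L_D\omega=\omega$ and $L_DH=\Lambda H$. Assume that the quotient $C=M/D$, in which two points are identified when they lie on a common integral curve of $D$, is a smooth manifold (of dimension $2n+1$) such that the projection $\pi:M\to C$ is a smooth surjective submersion. Let $\rho:M\to\mathbb R\setminus\{0\}$ be a smooth nowhere-vanishing global scaling function, $L_D\rho=\rho$. Put $\lambda=i_D\omega$, $\Sigma_0=\pi(\{H=0\})$, and let $\ell=\pi_*\,\mathrm{span}(X_H)$, that is, $\ell_{\pi(m)}=d\pi_m(\mathrm{span}\,X_H(m))$ for $m\in M$. On an open set $U\subseteq C$, the contact Hamiltonian vector field of a smooth function $h$ with respect to a contact form $\eta$ is the vector field $X$ on $U$ determined by $$i_X d\eta = dh-\mathscr R(h)\,\eta,\qquad i_X\eta=-h,$$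 where $\mathscr R$ is the Reeb vector field ($i_{\mathscr R}d\eta=0$, $i_{\mathscr R}\eta=1$). Then there is a unique $1$-form $\eta$ on $C$ with $\pi^*\eta=\lambda/\rho$, and it is a contact form; there is a unique function $\mathscr H_0:C\to\mathbb R$ with $\pi^*\mathscr H_0=-H/\rho^\Lambda$; and (i) $\mathscr H_0$ is smooth and has a unique contact Hamiltonian vector field $X_{\mathscr H_0}$ on $C$ with respect to $\eta$; it spans $\ell$ on $\Sigma_0$: for all $m\in M$ with $\pi(m)\in\Sigma_0$, $\mathrm{span}\,X_{\mathscr H_0}(\pi(m))=d\pi_m(\mathrm{span}\,X_H(m))$. (ii) The set $C\setminus\Sigma_0$ is open, the function $\mathscr H=-|\mathscr H_0|^{1/\Lambda}$ is smooth on it and has there a unique contact Hamiltonian vector field $X_{\mathscr H}$ with respect to $\eta$; it spans $\ell$ on $C\setminus\Sigma_0$: for all $m\in M$ with $\pi(m)\notin\Sigma_0$, $\mathrm{span}\,X_{\mathscr H}(\pi(m))=d\pi_m(\mathrm{span}\,X_H(m))$. Here, where $\rho<0$, the power $\rho^\Lambda$ is the usual real power $(-1)^p|\rho|^\Lambda$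 if $\Lambda=p/q$ is rational in lowest terms with $q$ odd (in particular if $\Lambda$ is an integer), and is read as $|\rho|^\Lambda$ for all other $\Lambda$, for which no real power exists. (In each fibre the subspaces in (i), (ii) may be zero, exactly where $\ell$ is.) -/

import Mathlib

open scoped Manifold ContDiff

noncomputable section

namespace ScalingReduction

section Forms

variable {E : Type*} [NormedAddCommGroup E] [NormedSpace ℝ E]
  {M : Type*} [TopologicalSpace M] [ChartedSpace E M]
  {F : Type*} [NormedAddCommGroup F] [NormedSpace ℝ F]
  {C : Type*} [TopologicalSpace C] [ChartedSpace F C]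

variable (E M) in
/-- (Not necessarily continuous) vector fields on a manifold without boundary modelled on `E`. -/
abbrev VField := ∀ x : M, TangentSpace 𝓘(ℝ, E) x

variable (E M) in
/-- (Not necessarily continuous) differential `k`-forms on a manifold modelled on `E`. -/
abbrev DForm (k : ℕ) := ∀ x : M, (TangentSpace 𝓘(ℝ, E) x) [⋀^Fin k]→L[ℝ] ℝ

/-- `V` is smooth on `U`, as a section of the tangent bundle. -/
def VField.SmoothOn [IsManifold 𝓘(ℝ, E) ∞ M] (V : VField E M) (U : Set M) : Prop :=
  ContMDiffOn 𝓘(ℝ, E) 𝓘(ℝ, E).tangent ∞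
    (fun x ↦ (⟨x, V x⟩ : TangentBundle 𝓘(ℝ, E) M)) U

/-- The vector field `V` read in the chart around `x₀`: a map `E → E`, meaningful on the target
of the chart. -/
def VField.inChart (V : VField E M) (x₀ : M) (y : E) : E :=
  mfderiv 𝓘(ℝ, E) 𝓘(ℝ, E) (extChartAt 𝓘(ℝ, E) x₀) ((extChartAt 𝓘(ℝ, E) x₀).symm y)
    (V ((extChartAt 𝓘(ℝ, E) x₀).symm y))

/-- The form `α` read in the chart around `x₀`, i.e. its pullback under the inverse of the chart;
meaningful on the target of the chart. -/
def DForm.inChart {k : ℕ} (α : DForm E M k) (x₀ : M) (y : E) : E [⋀^Fin k]→L[ℝ] ℝ :=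
  (α ((extChartAt 𝓘(ℝ, E) x₀).symm y)).compContinuousLinearMap
    (mfderiv 𝓘(ℝ, E) 𝓘(ℝ, E) (extChartAt 𝓘(ℝ, E) x₀).symm y)

/-- Smoothness of a differential form: its coefficients are smooth in every chart. -/
def DForm.Smooth {k : ℕ} (α : DForm E M k) : Prop :=
  ∀ x₀ : M, ContDiffOn ℝ ∞ (α.inChart x₀) (extChartAt 𝓘(ℝ, E) x₀).target

/-- The exterior derivative, computed at `x` in the chart around `x`. -/
def DForm.d {k : ℕ} (α : DForm E M k) : DForm E M (k + 1) := fun x ↦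
  (extDeriv (α.inChart x) (extChartAt 𝓘(ℝ, E) x x)).compContinuousLinearMap
    (mfderiv 𝓘(ℝ, E) 𝓘(ℝ, E) (extChartAt 𝓘(ℝ, E) x) x)

/-- The Lie derivative `L_V α`, computed at `x` in the chart around `x` by the coordinate formula
`(L_V α)(v₁, …, v_k) = (∂_V α)(v₁, …, v_k) + ∑ᵢ α(v₁, …, ∂_{vᵢ} V, …, v_k)`. -/
def DForm.lieDeriv {k : ℕ} (V : VField E M) (α : DForm E M k) (x : M)
    (v : Fin k → TangentSpace 𝓘(ℝ, E) x) : ℝ :=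
  let y : E := extChartAt 𝓘(ℝ, E) x x
  let w : Fin k → E := fun i ↦ mfderiv 𝓘(ℝ, E) 𝓘(ℝ, E) (extChartAt 𝓘(ℝ, E) x) x (v i)
  fderiv ℝ (α.inChart x) y (V.inChart x y) w +
    ∑ i, α.inChart x y (Function.update w i (fderiv ℝ (V.inChart x) y (w i)))

/-- The interior product `i_V α`. -/
def DForm.interior {k : ℕ} (V : VField E M) (α : DForm E M (k + 1)) : DForm E M k :=
  fun x ↦
    let a : E [⋀^Fin (k + 1)]→L[ℝ] ℝ := α x
    a.curryLeft (V x)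

/-- The pullback `π^* α` of a differential form. -/
def DForm.pullback {k : ℕ} (π : M → C) (α : DForm F C k) : DForm E M k := fun m ↦
  (α (π m)).compContinuousLinearMap (mfderiv 𝓘(ℝ, E) 𝓘(ℝ, F) π m)

/-- The differential `df` of a function, as a covector at each point. -/
def differential (f : M → ℝ) (x : M) : TangentSpace 𝓘(ℝ, E) x →L[ℝ] ℝ :=
  mfderiv 𝓘(ℝ, E) 𝓘(ℝ, ℝ) f x

/-- The derivative `L_V f = df(V)` of a function along a vector field. -/
def lieDerivFun (V : VField E M) (f : M → ℝ) (x : M) : ℝ :=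
  differential f x (V x)

/-- Symplectic forms: smooth, closed, non-degenerate 2-forms. -/
structure IsSymplectic (Ω : DForm E M 2) : Prop where
  smooth : Ω.Smooth
  closed : Ω.d = 0
  nondegenerate : ∀ x, ∀ u : TangentSpace 𝓘(ℝ, E) x, (∀ v, Ω x ![u, v] = 0) → u = 0

/-- `X` is the Hamiltonian vector field of `H`: `i_X Ω = -dH`. -/
def IsHamiltonianVField (Ω : DForm E M 2) (H : M → ℝ) (X : VField E M) : Prop :=
  ∀ x, ∀ v : TangentSpace 𝓘(ℝ, E) x, Ω x ![X x, v] = -differential H x v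

/-- `D` is a scaling symmetry of degree `Λ` for `(M, Ω, H)`: a smooth vector field with
`L_D Ω = Ω` and `L_D H = Λ H`. -/
structure IsScalingSymmetry [IsManifold 𝓘(ℝ, E) ∞ M] (Ω : DForm E M 2) (H : M → ℝ) (Λ : ℝ) (D : VField E M) : Prop where
  smooth : D.SmoothOn Set.univ
  form : ∀ x v, Ω.lieDeriv D x v = Ω x v
  hamiltonian : ∀ x, lieDerivFun D H x = Λ * H x

/-- `ρ` is a global, nowhere-vanishing scaling function for `D`. -/
structure IsScalingFunction (D : VField E M) (ρ : M → ℝ) : Prop where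
  smooth : ContMDiff 𝓘(ℝ, E) 𝓘(ℝ, ℝ) ∞ ρ
  ne_zero : ∀ x, ρ x ≠ 0
  scaling : ∀ x, lieDerivFun D ρ x = ρ x

/-- `m` and `m'` lie on a common integral curve of `D`, defined on some open interval. -/
def OnCommonIntegralCurve (D : VField E M) (m m' : M) : Prop :=
  ∃ (γ : ℝ → M) (s : Set ℝ), IsOpen s ∧ s.OrdConnected ∧
    IsMIntegralCurveOn (I := 𝓘(ℝ, E)) γ D s ∧ m ∈ γ '' s ∧ m' ∈ γ '' s

/-- The manifold `C`, with projection `π : M → C`, is the quotient `M/D`: `π` is a surjective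
smooth submersion, and its fibres are the orbits of `D`. -/
structure IsOrbitSpace (D : VField E M) (π : M → C) : Prop where
  smooth : ContMDiff 𝓘(ℝ, E) 𝓘(ℝ, F) ∞ π
  surjective : Function.Surjective π
  submersion : ∀ m, Function.Surjective (mfderiv 𝓘(ℝ, E) 𝓘(ℝ, F) π m)
  fibers : ∀ m m', π m = π m' ↔ OnCommonIntegralCurve D m m'

/-- Contact forms: smooth 1-forms `η` without zeros such that `dη` is non-degenerate on `ker η`.
On a manifold of dimension `2n + 1` this is the condition `η ∧ (dη)ⁿ ≠ 0` at every point. -/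
structure IsContactForm (η : DForm F C 1) : Prop where
  smooth : η.Smooth
  ne_zero : ∀ x, η x ≠ 0
  nondegenerate : ∀ x, ∀ u : TangentSpace 𝓘(ℝ, F) x, η x ![u] = 0 →
    (∀ v : TangentSpace 𝓘(ℝ, F) x, η x ![v] = 0 → η.d x ![u, v] = 0) → u = 0

/-- `r` is the value at `x` of the Reeb vector field: `i_r dη = 0` and `η(r) = 1`. -/
def IsReebVector (η : DForm F C 1) (x : C) (r : TangentSpace 𝓘(ℝ, F) x) : Prop :=
  (∀ v, η.d x ![r, v] = 0) ∧ η x ![r] = 1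

/-- On the open set `U`, `h` is a smooth function and `X` is its contact Hamiltonian vector field
with respect to the contact form `η`: with `R` the Reeb vector field,
`i_X dη = dh - R(h) η` and `i_X η = -h` on `U`. -/
structure IsContactHamiltonianVFieldOn [IsManifold 𝓘(ℝ, F) ∞ C] (η : DForm F C 1) (h : C → ℝ) (X : VField F C)
    (U : Set C) : Prop where
  isOpen : IsOpen U
  smooth : X.SmoothOn U
  hamiltonian_smooth : ContMDiffOn 𝓘(ℝ, F) 𝓘(ℝ, ℝ) ∞ h U
  interior_d : ∀ x ∈ U, ∃ r, IsReebVector η x r ∧ ∀ v : TangentSpace 𝓘(ℝ, F) x,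
    η.d x ![X x, v] = differential h x v - differential h x r * η x ![v]
  interior : ∀ x ∈ U, η x ![X x] = -h x

/-- `Y` spans on `S` the line field `ℓ = π_* span(X)`: for each `m` over a point of `S`, the
subspace `ℓ = dπ_m(span X(m))` is spanned by `Y(π(m))`. -/
def SpansProjectionOn (π : M → C) (X : VField E M) (Y : VField F C) (S : Set C) : Prop :=
  ∀ m, π m ∈ S →
    Submodule.span ℝ {Y (π m)} =
      (Submodule.span ℝ {X m}).map (mfderiv 𝓘(ℝ, E) 𝓘(ℝ, F) π m).toLinearMap

end Forms

open Classical in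
/-- The real power `x ^ a` for `x ≠ 0` of any sign. For `x < 0` and `a = p / q` in lowest terms with
`q` odd it is the usual real value `(-1)^p |x|^a` (so the ordinary power if `a` is an integer);
for `x < 0` and all other `a`, where no real value exists, it is by convention `|x|^a`. -/
def realPow (x a : ℝ) : ℝ :=
  if x < 0 ∧ ∃ q : ℚ, (q : ℝ) = a ∧ Odd q.num ∧ Odd q.den then -(|x| ^ a) else |x| ^ a

end ScalingReduction

end

/-!
Contact reduction of a symplectic Hamiltonian system by a scaling symmetry `D`, with scaling
function `ρ`.

The form `λ / ρ`, where `λ = i_D Ω`, annihilates `D`. As `L_D λ = λ` and `L_D ρ = ρ`, it is also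
invariant under `D`, so that it is the pullback of a 1-form `η` on the orbit space `C`
(`IsOrbitSpace.exists_pullback_eq`, resting on `IsOrbitSpace.hasDerivAt_lift`). No flow of `D` is
used: orbits are the fibres of `π`, and a quantity is shown to be constant on a fibre by
differentiating it along a single integral curve (`IsOrbitSpace.eq_of_hasDerivAt_zero`). Smoothness
on `C` is tested along local sections of `π` (`IsOrbitSpace.exists_section`).

Cartan's formula gives `dλ = Ω`, hence `π^* dη = Ω / ρ - dρ ∧ λ / ρ ^ 2`
(`DForm.d_smul_interior`). From this formula everything else is linear algebra at one point of
`M`, carried out in `IsPointReduction`. If `u` projects to a vector of `ker η` annihilated by `dη`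
on `ker η`, then `Ω(u, ·)` vanishes on `ker λ`; so `u` is a multiple of `D`, by non-degeneracy of
`Ω`, and projects to zero: `η` is a contact form. The Reeb vector field is the projection of the
Hamiltonian vector field of `ρ`, and the contact Hamiltonian vector field of a function `h` is the
projection of the Hamiltonian vector field of `-ρ π^*h`, the function homogeneous of degree one
that corresponds to `h` (`IsOrbitSpace.exists_contactHamiltonian`).

It remains to compare `ρ π^*h` with `H`, since the contact Hamiltonian vector of `h` spans the
projection of `span X_H` wherever `d (ρ π^*h)` is a nonzero multiple of `dH`
(`IsOrbitSpace.span_projection_eq`). For `h = H₀` one has `ρ π^*H₀ = -(ρ / ρ ^ Λ) H`, whose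
differential is `-(ρ / ρ ^ Λ) dH` at the points where `H = 0`. For `h = -|H₀| ^ (1 / Λ)` one has
`ρ π^*h = -(ρ / |ρ|) |H| ^ (1 / Λ)`, where `ρ / |ρ|` is locally constant, and the differential of
`|H| ^ (1 / Λ)` is a nonzero multiple of `dH` where `H ≠ 0`.
-/

namespace ScalingReduction

set_option linter.unusedSectionVars false

open Filter
open scoped Topology

/-! ### Calculus of forms in a vector space -/

section VectorSpace

variable {E : Type*} [NormedAddCommGroup E] [NormedSpace ℝ E]
  {F : Type*} [NormedAddCommGroup F] [NormedSpace ℝ F]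

theorem fderiv_twoForm_apply {Ω : E → E [⋀^Fin 2]→L[ℝ] ℝ} {a b : E → E} {y : E}
    (hΩ : DifferentiableAt ℝ Ω y) (ha : DifferentiableAt ℝ a y) (hb : DifferentiableAt ℝ b y)
    (w : E) :
    fderiv ℝ (fun z ↦ Ω z ![a z, b z]) y w =
      fderiv ℝ Ω y w ![a y, b y] + Ω y ![fderiv ℝ a y w, b y] + Ω y ![a y, fderiv ℝ b y w] := by
  have hg : ∀ i : Fin 2, HasFDerivAt (fun z ↦ (![a z, b z] : Fin 2 → E) i)
      ((![fderiv ℝ a y, fderiv ℝ b y] : Fin 2 → E →L[ℝ] E) i) y := by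
    intro i
    fin_cases i
    · exact ha.hasFDerivAt
    · exact hb.hasFDerivAt
  have key := (hΩ.hasFDerivAt.continuousAlternatingMap_apply hg).fderiv
  have h1 : (fun z ↦ Ω z ![a z, b z]) =
      fun z ↦ Ω z (fun i ↦ (![a z, b z] : Fin 2 → E) i) := rfl
  have e0 : ∀ c : E, Function.update (![a y, b y] : Fin 2 → E) 0 c = ![c, b y] := by
    intro c; ext i; fin_cases i <;> rfl
  have e1 : ∀ c : E, Function.update (![a y, b y] : Fin 2 → E) 1 c = ![a y, c] := by
    intro c; ext i; fin_cases i <;> rfl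
  rw [h1, key]
  simp [Fin.sum_univ_two, e0, e1, add_assoc]

theorem twoForm_swap (Ω : E [⋀^Fin 2]→L[ℝ] ℝ) (u v : E) : Ω ![u, v] = -Ω ![v, u] := by
  have h := Ω.map_swap ![v, u] (show (0 : Fin 2) ≠ 1 by decide)
  have e : ![v, u] ∘ Equiv.swap (0 : Fin 2) 1 = ![u, v] := by ext i; fin_cases i <;> rfl
  rw [e] at h
  exact h

theorem twoForm_self (Ω : E [⋀^Fin 2]→L[ℝ] ℝ) (u : E) : Ω ![u, u] = 0 := by
  linarith [twoForm_swap Ω u u]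

variable (E) in
/-- Currying of 2-forms, as a continuous linear map. -/
noncomputable def curryTwoL : (E [⋀^Fin 2]→L[ℝ] ℝ) →L[ℝ] E →L[ℝ] E [⋀^Fin 1]→L[ℝ] ℝ :=
  (ContinuousAlternatingMap.curryLeftLI (𝕜 := ℝ) (E := E) (F := ℝ)
    (n := 1)).toContinuousLinearMap

variable (E) in
/-- The identification of 1-forms with continuous linear functionals. -/
noncomputable def oneFormL : (E [⋀^Fin 1]→L[ℝ] ℝ) →L[ℝ] E →L[ℝ] ℝ :=
  (ContinuousAlternatingMap.ofSubsingletonLIE (𝕜 := ℝ) (E := E) (F := ℝ)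
    (0 : Fin 1)).symm.toContinuousLinearEquiv.toContinuousLinearMap

variable (E) in
/-- The inverse of `oneFormL`. -/
noncomputable def oneFormSymmL : (E →L[ℝ] ℝ) →L[ℝ] E [⋀^Fin 1]→L[ℝ] ℝ :=
  (ContinuousAlternatingMap.ofSubsingletonLIE (𝕜 := ℝ) (E := E) (F := ℝ)
    (0 : Fin 1)).toContinuousLinearEquiv.toContinuousLinearMap

@[simp]
theorem oneFormL_apply (α : E [⋀^Fin 1]→L[ℝ] ℝ) (v : E) : oneFormL E α v = α ![v] := by
  change α (fun _ ↦ v) = α ![v]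
  congr 1
  ext i; fin_cases i; rfl

@[simp]
theorem oneFormSymmL_apply (l : E →L[ℝ] ℝ) (v : E) : oneFormSymmL E l ![v] = l v := rfl

variable (E) in
/-- A 2-form `Ω`, as the linear map sending `u` to the covector `Ω(u, ·)`. -/
noncomputable def flatL : (E [⋀^Fin 2]→L[ℝ] ℝ) →L[ℝ] E →L[ℝ] E →L[ℝ] ℝ :=
  ContinuousLinearMap.compL ℝ E (E [⋀^Fin 1]→L[ℝ] ℝ) (E →L[ℝ] ℝ) (oneFormL E) ∘L curryTwoL E

@[simp]
theorem flatL_apply (Ω : E [⋀^Fin 2]→L[ℝ] ℝ) (u v : E) : flatL E Ω u v = Ω ![u, v] := by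
  change oneFormL E (Ω.curryLeft u) v = _
  rw [oneFormL_apply]; rfl

theorem twoForm_smul_left (Ω : E [⋀^Fin 2]→L[ℝ] ℝ) (k : ℝ) (u v : E) :
    Ω ![k • u, v] = k * Ω ![u, v] := by
  rw [← flatL_apply, ← flatL_apply, map_smul]
  rfl

theorem twoForm_congr_of_sub_eq_smul (Ω : E [⋀^Fin 2]→L[ℝ] ℝ) {d u u' : E} {c : ℝ}
    (h : u - u' = c • d) : Ω ![d, u] = Ω ![d, u'] := by
  rw [← sub_eq_zero, ← flatL_apply, ← flatL_apply, ← map_sub, h, map_smul, flatL_apply,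
    twoForm_self, smul_zero]

theorem oneForm_ext {α β : E [⋀^Fin 1]→L[ℝ] ℝ} (h : ∀ v, α ![v] = β ![v]) : α = β := by
  ext v
  have : v = ![v 0] := by ext i; fin_cases i; rfl
  rw [this]; exact h _

theorem extDeriv_oneForm_apply {α : E → E [⋀^Fin 1]→L[ℝ] ℝ} {y : E} (u v : E) :
    extDeriv α y ![u, v] = fderiv ℝ α y u ![v] - fderiv ℝ α y v ![u] := by
  have e0 : (0 : Fin 2).removeNth ![u, v] = ![v] := by ext i; fin_cases i; rfl
  have e1 : (1 : Fin 2).removeNth ![u, v] = ![u] := by ext i; fin_cases i; rfl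
  rw [extDeriv, ContinuousAlternatingMap.alternatizeUncurryFin_apply, Fin.sum_univ_two, e0, e1]
  simp [sub_eq_add_neg]

theorem extDeriv_twoForm_apply {Ω : E → E [⋀^Fin 2]→L[ℝ] ℝ} {y : E} (a b c : E) :
    extDeriv Ω y ![a, b, c] =
      fderiv ℝ Ω y a ![b, c] - fderiv ℝ Ω y b ![a, c] + fderiv ℝ Ω y c ![a, b] := by
  have e0 : (0 : Fin 3).removeNth ![a, b, c] = ![b, c] := by ext i; fin_cases i <;> rfl
  have e1 : (1 : Fin 3).removeNth ![a, b, c] = ![a, c] := by ext i; fin_cases i <;> rfl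
  have e2 : (2 : Fin 3).removeNth ![a, b, c] = ![a, b] := by ext i; fin_cases i <;> rfl
  rw [extDeriv, ContinuousAlternatingMap.alternatizeUncurryFin_apply, Fin.sum_univ_three, e0, e1,
    e2]
  simp [sub_eq_add_neg]

theorem fderiv_inv_apply {r : E → ℝ} {y : E} (hr : DifferentiableAt ℝ r y) (hr0 : r y ≠ 0)
    (a : E) : fderiv ℝ (fun z ↦ (r z)⁻¹) y a = -((r y)⁻¹ ^ 2 * fderiv ℝ r y a) := by
  have h : HasFDerivAt (fun x : ℝ ↦ x⁻¹) _ (r y) := (hasDerivAt_inv hr0).hasFDerivAt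
  have h' : fderiv ℝ (fun z ↦ (r z)⁻¹) y = _ := (h.comp y hr.hasFDerivAt).fderiv
  rw [h']
  simp [mul_comm]

theorem contDiff_curryTwoL {n : WithTop ℕ∞} : ContDiff ℝ n (curryTwoL E) :=
  ContinuousLinearMap.contDiff _

theorem contDiff_oneFormL {n : WithTop ℕ∞} : ContDiff ℝ n (oneFormL E) :=
  ContinuousLinearMap.contDiff _

theorem contDiff_oneFormSymmL {n : WithTop ℕ∞} : ContDiff ℝ n (oneFormSymmL E) :=
  ContinuousLinearMap.contDiff _

theorem contDiff_flatL {n : WithTop ℕ∞} : ContDiff ℝ n (flatL E) :=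
  ContinuousLinearMap.contDiff _

/-- The condition `L_D Ω = Ω` at the point `y` of a vector space, evaluated on a pair of vectors. -/
def LieEqSelfAt (D : E → E) (Ω : E → E [⋀^Fin 2]→L[ℝ] ℝ) (y : E) : Prop :=
  ∀ u v, fderiv ℝ Ω y (D y) ![u, v] + Ω y ![fderiv ℝ D y u, v] + Ω y ![u, fderiv ℝ D y v] =
    Ω y ![u, v]

/-- The coordinate formula behind `DForm.lieDeriv` involves the differential `T` of the chart at its
centre, which is the identity, but only propositionally so. -/
theorem LieEqSelfAt.of_coordinates {D : E → E} {Ω : E → E [⋀^Fin 2]→L[ℝ] ℝ} {y : E}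
    {T : E → E} (hT : ∀ v, T v = v)
    (h : ∀ v : Fin 2 → E, fderiv ℝ Ω y (D y) (fun i ↦ T (v i)) +
      ∑ i, Ω y (Function.update (fun i ↦ T (v i)) i (fderiv ℝ D y (T (v i)))) = Ω y v) :
    LieEqSelfAt D Ω y := by
  intro u v
  have e0 : ∀ c : E, Function.update (![u, v] : Fin 2 → E) 0 c = ![c, v] := by
    intro c; ext i; fin_cases i <;> rfl
  have e1 : ∀ c : E, Function.update (![u, v] : Fin 2 → E) 1 c = ![u, c] := by
    intro c; ext i; fin_cases i <;> rfl
  have h' := h ![u, v]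
  simp only [hT] at h'
  have hw : (fun i ↦ (![u, v] : Fin 2 → E) i) = ![u, v] := rfl
  rw [Fin.sum_univ_two, hw, e0, e1, ← add_assoc] at h'
  exact h'

theorem differentiableAt_smul_curryLeft {Ω : E → E [⋀^Fin 2]→L[ℝ] ℝ} {D : E → E} {r : E → ℝ}
    {y : E} (hΩ : DifferentiableAt ℝ Ω y) (hD : DifferentiableAt ℝ D y)
    (hr : DifferentiableAt ℝ r y) (hr0 : r y ≠ 0) :
    DifferentiableAt ℝ (fun z ↦ (r z)⁻¹ • (Ω z).curryLeft (D z)) y := by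
  have h : DifferentiableAt ℝ (curryTwoL E ∘ Ω) y :=
    ((contDiff_curryTwoL (E := E) (n := 1)).differentiable one_ne_zero _).comp y hΩ
  have h' : DifferentiableAt ℝ (fun z ↦ (Ω z).curryLeft (D z)) y :=
    DifferentiableAt.clm_apply (c := fun z ↦ curryTwoL E (Ω z)) h hD
  exact (hr.fun_inv hr0).fun_smul h'

/-- Cartan's formula for a closed 2-form with `L_D Ω = Ω` gives `d (i_D Ω) = Ω`; the remaining
terms come from the factor `1 / r`. -/
theorem extDeriv_smul_curryLeft {Ω : E → E [⋀^Fin 2]→L[ℝ] ℝ} {D : E → E} {r : E → ℝ}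
    {y : E} (hΩ : DifferentiableAt ℝ Ω y) (hD : DifferentiableAt ℝ D y)
    (hr : DifferentiableAt ℝ r y) (hr0 : r y ≠ 0) (hclosed : extDeriv Ω y = 0)
    (hlie : LieEqSelfAt D Ω y) (u v : E) :
    extDeriv (fun z ↦ (r z)⁻¹ • (Ω z).curryLeft (D z)) y ![u, v] =
      (r y)⁻¹ * Ω y ![u, v] - (r y)⁻¹ ^ 2 *
        (fderiv ℝ r y u * Ω y ![D y, v] - fderiv ℝ r y v * Ω y ![D y, u]) := by
  have hdiff := differentiableAt_smul_curryLeft hΩ hD hr hr0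
  have h1 : ∀ a b : E, fderiv ℝ (fun z ↦ (r z)⁻¹ • (Ω z).curryLeft (D z)) y a ![b] =
      (r y)⁻¹ * (fderiv ℝ Ω y a ![D y, b] + Ω y ![fderiv ℝ D y a, b])
        - (r y)⁻¹ ^ 2 * fderiv ℝ r y a * Ω y ![D y, b] := by
    intro a b
    rw [← fderiv_continuousAlternatingMap_apply_const_apply hdiff]
    have e : (fun z ↦ ((r z)⁻¹ • (Ω z).curryLeft (D z)) ![b]) =
        fun z ↦ (r z)⁻¹ * Ω z ![D z, b] := by
      ext z; simp
    have hd : DifferentiableAt ℝ (fun z ↦ Ω z ![D z, b]) y := by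
      refine hΩ.continuousAlternatingMap_apply (g := fun i z ↦ (![D z, b] : Fin 2 → E) i) ?_
      intro i
      fin_cases i
      · exact hD
      · exact differentiableAt_const b
    rw [e, fderiv_fun_mul (hr.fun_inv hr0) hd]
    have h2 := fderiv_twoForm_apply (b := fun _ ↦ b) hΩ hD (differentiableAt_const b) a
    simp only [fderiv_fun_const, Pi.zero_apply, zero_apply] at h2
    have h0 : Ω y ![D y, 0] = 0 := (Ω y).map_coord_zero 1 rfl
    simp only [add_apply, smul_apply, smul_eq_mul]
    rw [h2, h0, fderiv_inv_apply hr hr0]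
    ring
  rw [extDeriv_oneForm_apply, h1, h1]
  have h3 := extDeriv_twoForm_apply (Ω := Ω) (y := y) (D y) u v
  rw [hclosed] at h3
  rw [show (0 : E [⋀^Fin 3]→L[ℝ] ℝ) ![D y, u, v] = 0 from rfl] at h3
  have h4 := hlie u v
  -- Closedness evaluated on `(D, u, v)` turns `L_D Ω = Ω` into `d (i_D Ω) = Ω`.
  have h5 := twoForm_swap (Ω y) u (fderiv ℝ D y v)
  rw [h5] at h4
  linear_combination (r y)⁻¹ * h4 + (r y)⁻¹ * h3

/-- The 1-form `i_D Ω / r` is constant in the direction of `D`, when evaluated on a vector field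
`W` which projects under `P` to a constant vector: the bracket `[D, W]` is then tangent to the
fibres of `P`, hence a multiple of `D`, and does not contribute since `Ω(D, D) = 0`. -/
theorem fderiv_lift_eq_zero {Ω : E → E [⋀^Fin 2]→L[ℝ] ℝ} {D W : E → E} {r : E → ℝ} {P : E → F}
    {y : E} {v : F} (hΩ : DifferentiableAt ℝ Ω y) (hD : DifferentiableAt ℝ D y)
    (hW : DifferentiableAt ℝ W y) (hr : DifferentiableAt ℝ r y) (hr0 : r y ≠ 0)
    (hP : ContDiffAt ℝ 2 P y) (hlie : LieEqSelfAt D Ω y) (hrD : fderiv ℝ r y (D y) = r y)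
    (hPD : ∀ᶠ z in 𝓝 y, fderiv ℝ P z (D z) = 0) (hPW : ∀ᶠ z in 𝓝 y, fderiv ℝ P z (W z) = v)
    (hker : ∀ u, fderiv ℝ P y u = 0 → ∃ c : ℝ, u = c • D y) :
    fderiv ℝ (fun z ↦ (r z)⁻¹ * Ω z ![D z, W z]) y (D y) = 0 := by
  have hP' : DifferentiableAt ℝ (fderiv ℝ P) y :=
    (hP.fderiv_right (m := 1) le_rfl).differentiableAt one_ne_zero
  have hsymm : IsSymmSndFDerivAt ℝ P y := hP.isSymmSndFDerivAt (by simp)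
  -- Differentiate `dP(D) = 0` along `W` and `dP(W) = v` along `D`; subtracting, `dP([D, W]) = 0`.
  have hb1 : fderiv ℝ (fderiv ℝ P) y (W y) (D y) + fderiv ℝ P y (fderiv ℝ D y (W y)) = 0 := by
    have h := (hP'.hasFDerivAt.clm_apply hD.hasFDerivAt).congr_of_eventuallyEq
      (hPD.mono fun z hz ↦ hz.symm : (fun _ ↦ (0 : F)) =ᶠ[𝓝 y] _)
    have := congrArg (fun L ↦ L (W y)) (h.unique (hasFDerivAt_const (0 : F) y))
    simpa [add_comm] using this
  have hb2 : fderiv ℝ (fderiv ℝ P) y (D y) (W y) + fderiv ℝ P y (fderiv ℝ W y (D y)) = 0 := by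
    have h := (hP'.hasFDerivAt.clm_apply hW.hasFDerivAt).congr_of_eventuallyEq
      (hPW.mono fun z hz ↦ hz.symm : (fun _ ↦ v) =ᶠ[𝓝 y] _)
    have := congrArg (fun L ↦ L (D y)) (h.unique (hasFDerivAt_const v y))
    simpa [add_comm] using this
  obtain ⟨c, hc⟩ := hker (fderiv ℝ W y (D y) - fderiv ℝ D y (W y)) (by
    rw [map_sub]
    rw [hsymm.eq (W y) (D y)] at hb1
    have := hb2.trans hb1.symm
    exact sub_eq_zero.2 (add_left_cancel this))
  have hd : DifferentiableAt ℝ (fun z ↦ Ω z ![D z, W z]) y := by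
    refine hΩ.continuousAlternatingMap_apply (g := fun i z ↦ (![D z, W z] : Fin 2 → E) i) ?_
    intro i
    fin_cases i
    · exact hD
    · exact hW
  rw [fderiv_fun_mul (hr.fun_inv hr0) hd]
  have hinv : fderiv ℝ (fun z ↦ (r z)⁻¹) y (D y) = -(r y)⁻¹ := by
    rw [fderiv_inv_apply hr hr0, hrD]
    field_simp
  simp only [add_apply, smul_apply, smul_eq_mul]
  rw [fderiv_twoForm_apply hΩ hD hW, hinv]
  have h4 := hlie (D y) (W y)
  rw [twoForm_congr_of_sub_eq_smul (Ω y) hc]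
  linear_combination (r y)⁻¹ * h4

/-- Near a point where the derivative of `P` is onto, constant vectors have smooth lifts. -/
theorem exists_lift_vector [FiniteDimensional ℝ E] [FiniteDimensional ℝ F] {P : E → F} {y : E}
    (hP : ContDiffAt ℝ 2 P y) (hs : Function.Surjective (fderiv ℝ P y)) (v : F) :
    ∃ W : E → E, DifferentiableAt ℝ W y ∧ ∀ᶠ z in 𝓝 y, fderiv ℝ P z (W z) = v := by
  have := FiniteDimensional.complete ℝ F
  obtain ⟨R, hR⟩ := (fderiv ℝ P y).exists_rightInverse_of_surjective
    (LinearMap.range_eq_top.2 hs)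
  have hP' : ContDiffAt ℝ 1 (fderiv ℝ P) y := hP.fderiv_right (m := 1) le_rfl
  have hA : ContDiffAt ℝ 1 (fun z ↦ fderiv ℝ P z ∘L R) y := hP'.clm_comp contDiffAt_const
  have he : fderiv ℝ P y ∘L R = (ContinuousLinearEquiv.refl ℝ F : F →L[ℝ] F) := by
    rw [hR]; rfl
  have hI : ContDiffAt ℝ 1 (fun z ↦ (fderiv ℝ P z ∘L R).inverse) y :=
    ContDiffAt.comp y (g := ContinuousLinearMap.inverse)
      (by rw [he]; exact contDiffAt_map_inverse _) hA
  -- `dP_z ∘ R` is the identity at `y`, hence invertible nearby, and correcting `R` by its inverse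
  -- gives a right inverse of `dP_z`.
  refine ⟨fun z ↦ R ((fderiv ℝ P z ∘L R).inverse v), ?_, ?_⟩
  · exact R.differentiableAt.comp y
      ((hI.differentiableAt one_ne_zero).clm_apply (differentiableAt_const v))
  · have hopen : ∀ᶠ z in 𝓝 y, fderiv ℝ P z ∘L R ∈
        Set.range ((↑) : (F ≃L[ℝ] F) → F →L[ℝ] F) :=
      hA.continuousAt.eventually_mem (by
        rw [he]; exact ContinuousLinearEquiv.nhds _)
    filter_upwards [hopen] with z ⟨e, hz⟩
    rw [← hz, ContinuousLinearMap.inverse_equiv]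
    have : (e : F →L[ℝ] F) (e.symm v) = v := by simp
    rw [hz] at this
    exact this

/-- A submersion has smooth local sections. -/
theorem exists_local_section [FiniteDimensional ℝ E] [FiniteDimensional ℝ F] {P : E → F} {y : E}
    (hP : ContDiffAt ℝ ∞ P y) (hs : Function.Surjective (fderiv ℝ P y)) :
    ∃ τ : F → E, ContDiffAt ℝ ∞ τ (P y) ∧ τ (P y) = y ∧ ∀ᶠ z in 𝓝 (P y), P (τ z) = z := by
  have := FiniteDimensional.complete ℝ F
  obtain ⟨R, hR⟩ := (fderiv ℝ P y).exists_rightInverse_of_surjective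
    (LinearMap.range_eq_top.2 hs)
  have hd : ContDiffAt ℝ ∞ (fun w : F ↦ y + R w) 0 :=
    contDiffAt_const.add R.contDiff.contDiffAt
  have hP0 : ContDiffAt ℝ ∞ P ((fun w : F ↦ y + R w) 0) := by simpa using hP
  have hQ : ContDiffAt ℝ ∞ (fun w : F ↦ P (y + R w)) 0 := hP0.comp (0 : F) hd
  have hQ' : HasFDerivAt (fun w : F ↦ P (y + R w))
      ((ContinuousLinearEquiv.refl ℝ F : F ≃L[ℝ] F) : F →L[ℝ] F) 0 := by
    have h1 : HasFDerivAt (fun w : F ↦ y + R w) R 0 := R.hasFDerivAt.const_add y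
    have h2 : HasFDerivAt P (fderiv ℝ P y) (y + R 0) := by
      simpa using (hP.differentiableAt (by simp)).hasFDerivAt
    have h3 := h2.comp (0 : F) h1
    rw [hR] at h3
    exact h3
  have h0 : P (y + R 0) = P y := by simp
  have hn : (∞ : WithTop ℕ∞) ≠ 0 := by simp
  -- `w ↦ P (y + R w)` is a local diffeomorphism at `0`, and its inverse gives the section.
  refine ⟨fun z ↦ y + R (hQ.localInverse hQ' hn z), ?_, ?_, ?_⟩
  · have := hQ.to_localInverse hQ' hn
    rw [h0] at this
    exact contDiffAt_const.add (R.contDiff.contDiffAt.comp (P y) this)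
  · have := hQ.localInverse_apply_image hQ' hn
    rw [h0] at this
    simp [this]
  · have := (hQ.hasStrictFDerivAt' hQ' hn).eventually_right_inverse
    rw [h0] at this
    exact this

end VectorSpace

/-! ### Forms and vector fields in charts -/

section Charts

variable {E : Type*} [NormedAddCommGroup E] [NormedSpace ℝ E]
  {M : Type*} [TopologicalSpace M] [ChartedSpace E M] [IsManifold 𝓘(ℝ, E) ∞ M]
  {F : Type*} [NormedAddCommGroup F] [NormedSpace ℝ F]
  {C : Type*} [TopologicalSpace C] [ChartedSpace F C] [IsManifold 𝓘(ℝ, F) ∞ C]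

theorem minSmoothness_two_le_infty : minSmoothness ℝ 2 ≤ (∞ : WithTop ℕ∞) := by
  rw [minSmoothness_of_isRCLikeNormedField]
  exact WithTop.coe_le_coe.2 (le_top : (2 : ℕ∞) ≤ ⊤)

variable (E) in
theorem mdifferentiableAt_extChartAt_symm {x : M} {y : E}
    (hy : y ∈ (extChartAt 𝓘(ℝ, E) x).target) :
    MDifferentiableAt 𝓘(ℝ, E) 𝓘(ℝ, E) (extChartAt 𝓘(ℝ, E) x).symm y := by
  have h := mdifferentiableWithinAt_extChartAt_symm (I := 𝓘(ℝ, E)) hy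
  rwa [ModelWithCorners.range_eq_univ, mdifferentiableWithinAt_univ] at h

theorem contMDiffAt_extChartAt_symm {x : M} {y : E}
    (hy : y ∈ (extChartAt 𝓘(ℝ, E) x).target) :
    ContMDiffAt 𝓘(ℝ, E) 𝓘(ℝ, E) ∞ (extChartAt 𝓘(ℝ, E) x).symm y :=
  (contMDiffOn_extChartAt_symm x).contMDiffAt ((isOpen_extChartAt_target x).mem_nhds hy)

theorem mfderiv_symm_mfderiv_extChartAt {x : M} {y : E}
    (hy : y ∈ (extChartAt 𝓘(ℝ, E) x).target)
    (v : TangentSpace 𝓘(ℝ, E) ((extChartAt 𝓘(ℝ, E) x).symm y)) :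
    mfderiv 𝓘(ℝ, E) 𝓘(ℝ, E) (extChartAt 𝓘(ℝ, E) x).symm y
      (mfderiv 𝓘(ℝ, E) 𝓘(ℝ, E) (extChartAt 𝓘(ℝ, E) x) ((extChartAt 𝓘(ℝ, E) x).symm y) v)
      = v := by
  have h := mfderivWithin_extChartAt_symm_comp_mfderiv_extChartAt (I := 𝓘(ℝ, E)) hy
  rw [ModelWithCorners.range_eq_univ, mfderivWithin_univ] at h
  exact congrArg (fun L : E →L[ℝ] E ↦ L v) h

theorem mfderiv_extChartAt_symm_self (x : M) (v : E) :
    mfderiv 𝓘(ℝ, E) 𝓘(ℝ, E) (extChartAt 𝓘(ℝ, E) x).symm (extChartAt 𝓘(ℝ, E) x x) v = v := by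
  have h := mfderivWithin_range_extChartAt_symm (I := 𝓘(ℝ, E)) (x := x)
  rw [ModelWithCorners.range_eq_univ, mfderivWithin_univ] at h
  exact congrArg (fun L : E →L[ℝ] E ↦ L v) h

theorem mfderiv_extChartAt_self_apply (x : M) (v : TangentSpace 𝓘(ℝ, E) x) :
    mfderiv 𝓘(ℝ, E) 𝓘(ℝ, E) (extChartAt 𝓘(ℝ, E) x) x v = v :=
  congrArg (fun L : E →L[ℝ] E ↦ L v) (mfderiv_extChartAt_self (I := 𝓘(ℝ, E)) (x := x))

/-! ### Values at the centre of a chart -/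

theorem VField.inChart_self (V : VField E M) (x : M) :
    V.inChart x (extChartAt 𝓘(ℝ, E) x x) = V x := by
  have h : ∀ p : M, p = x →
      mfderiv 𝓘(ℝ, E) 𝓘(ℝ, E) (extChartAt 𝓘(ℝ, E) x) p (V p) = (V x : E) := by
    rintro p rfl
    exact mfderiv_extChartAt_self_apply p (V p)
  exact h _ (extChartAt_to_inv x)

theorem DForm.inChart_self {k : ℕ} (α : DForm E M k) (x : M) :
    α.inChart x (extChartAt 𝓘(ℝ, E) x x) = α x := by
  have h : ∀ (p : M) (L : E →L[ℝ] E), p = x → L = ContinuousLinearMap.id ℝ E →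
      (show E [⋀^Fin k]→L[ℝ] ℝ from α p).compContinuousLinearMap L = α x := by
    rintro p L rfl rfl
    ext v
    rfl
  refine h _ _ (extChartAt_to_inv x) ?_
  ext v
  exact mfderiv_extChartAt_symm_self (E := E) x v

/-- At the centre of a chart the differential of the chart is the identity, so that `DForm.d` is the
exterior derivative of the coordinate form. -/
theorem DForm.d_eq {k : ℕ} (α : DForm E M k) (x : M) :
    α.d x = (show E [⋀^Fin (k + 1)]→L[ℝ] ℝ from
      extDeriv (α.inChart x) (extChartAt 𝓘(ℝ, E) x x)) := by
  refine ContinuousAlternatingMap.ext fun v ↦ ?_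
  refine congrArg (show E [⋀^Fin (k + 1)]→L[ℝ] ℝ from
    extDeriv (α.inChart x) (extChartAt 𝓘(ℝ, E) x x)) ?_
  ext i
  exact mfderiv_extChartAt_self_apply x (v i)

theorem fderiv_comp_extChartAt_symm_self {G : Type*} [NormedAddCommGroup G] [NormedSpace ℝ G]
    {g : M → G} {x : M} (hg : MDifferentiableAt 𝓘(ℝ, E) 𝓘(ℝ, G) g x) (v : E) :
    fderiv ℝ (fun y ↦ g ((extChartAt 𝓘(ℝ, E) x).symm y)) (extChartAt 𝓘(ℝ, E) x x) v =
      mfderiv 𝓘(ℝ, E) 𝓘(ℝ, G) g x v := by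
  rw [hg.mfderiv, ModelWithCorners.range_eq_univ, fderivWithin_univ]
  rfl

/-! ### Maps between manifolds in charts -/

variable (E F) in
/-- The map `f` read in the charts around `x₀` and `c₀`. -/
noncomputable def chartRep (f : M → C) (x₀ : M) (c₀ : C) (y : E) : F :=
  extChartAt 𝓘(ℝ, F) c₀ (f ((extChartAt 𝓘(ℝ, E) x₀).symm y))

theorem fderiv_chartRep {f : M → C} {x₀ : M} {c₀ : C} {y : E}
    (hy : y ∈ (extChartAt 𝓘(ℝ, E) x₀).target)
    (hc : f ((extChartAt 𝓘(ℝ, E) x₀).symm y) ∈ (extChartAt 𝓘(ℝ, F) c₀).source)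
    (hf : MDifferentiableAt 𝓘(ℝ, E) 𝓘(ℝ, F) f ((extChartAt 𝓘(ℝ, E) x₀).symm y)) (v : E) :
    fderiv ℝ (chartRep E F f x₀ c₀) y v =
      mfderiv 𝓘(ℝ, F) 𝓘(ℝ, F) (extChartAt 𝓘(ℝ, F) c₀) (f ((extChartAt 𝓘(ℝ, E) x₀).symm y))
        (mfderiv 𝓘(ℝ, E) 𝓘(ℝ, F) f ((extChartAt 𝓘(ℝ, E) x₀).symm y)
          (mfderiv 𝓘(ℝ, E) 𝓘(ℝ, E) (extChartAt 𝓘(ℝ, E) x₀).symm y v)) := by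
  have h1 : MDifferentiableAt 𝓘(ℝ, F) 𝓘(ℝ, F) (extChartAt 𝓘(ℝ, F) c₀)
      (f ((extChartAt 𝓘(ℝ, E) x₀).symm y)) :=
    mdifferentiableAt_extChartAt (by rwa [extChartAt_source] at hc)
  have h2 := mdifferentiableAt_extChartAt_symm E hy
  have h3 := h1.hasMFDerivAt.comp y (hf.hasMFDerivAt.comp y h2.hasMFDerivAt)
  rw [← mfderiv_eq_fderiv]
  exact congrArg (fun L : E →L[ℝ] F ↦ L v) h3.mfderiv

theorem contDiffAt_chartRep {f : M → C} {x₀ : M} {c₀ : C} {y : E}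
    (hy : y ∈ (extChartAt 𝓘(ℝ, E) x₀).target)
    (hc : f ((extChartAt 𝓘(ℝ, E) x₀).symm y) ∈ (extChartAt 𝓘(ℝ, F) c₀).source)
    (hf : ContMDiffAt 𝓘(ℝ, E) 𝓘(ℝ, F) ∞ f ((extChartAt 𝓘(ℝ, E) x₀).symm y)) :
    ContDiffAt ℝ ∞ (chartRep E F f x₀ c₀) y := by
  have h1 : ContMDiffAt 𝓘(ℝ, F) 𝓘(ℝ, F) ∞ (extChartAt 𝓘(ℝ, F) c₀)
      (f ((extChartAt 𝓘(ℝ, E) x₀).symm y)) :=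
    contMDiffAt_extChartAt' (by rwa [extChartAt_source] at hc)
  exact (h1.comp y (hf.comp y (contMDiffAt_extChartAt_symm hy))).contDiffAt

theorem eventually_mem_target {x₀ : M} {y : E} (hy : y ∈ (extChartAt 𝓘(ℝ, E) x₀).target) :
    ∀ᶠ z in 𝓝 y, z ∈ (extChartAt 𝓘(ℝ, E) x₀).target :=
  (isOpen_extChartAt_target x₀).mem_nhds hy

theorem eventually_extChartAt_symm {x₀ : M} {y : E} (hy : y ∈ (extChartAt 𝓘(ℝ, E) x₀).target)
    {p : M → Prop} (hp : ∀ᶠ m in 𝓝 ((extChartAt 𝓘(ℝ, E) x₀).symm y), p m) :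
    ∀ᶠ z in 𝓝 y, p ((extChartAt 𝓘(ℝ, E) x₀).symm z) :=
  (contMDiffAt_extChartAt_symm hy).continuousAt.eventually hp

theorem fderiv_chartRep_self {f : M → C} {x : M}
    (hf : MDifferentiableAt 𝓘(ℝ, E) 𝓘(ℝ, F) f x) (v : E) :
    fderiv ℝ (chartRep E F f x (f x)) (extChartAt 𝓘(ℝ, E) x x) v =
      mfderiv 𝓘(ℝ, E) 𝓘(ℝ, F) f x v := by
  rw [hf.mfderiv, ModelWithCorners.range_eq_univ, fderivWithin_univ]
  rfl

/-- In charts, the pullback of forms along a map is the pullback along its coordinate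
representation. -/
theorem DForm.inChart_pullback {k : ℕ} {f : M → C} (η : DForm F C k) {x₀ : M} {c₀ : C} {y : E}
    (hy : y ∈ (extChartAt 𝓘(ℝ, E) x₀).target)
    (hc : f ((extChartAt 𝓘(ℝ, E) x₀).symm y) ∈ (extChartAt 𝓘(ℝ, F) c₀).source)
    (hf : MDifferentiableAt 𝓘(ℝ, E) 𝓘(ℝ, F) f ((extChartAt 𝓘(ℝ, E) x₀).symm y)) :
    (DForm.pullback (E := E) f η).inChart x₀ y =
      (η.inChart c₀ (chartRep E F f x₀ c₀ y)).compContinuousLinearMap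
        (fderiv ℝ (chartRep E F f x₀ c₀) y) := by
  have h : ∀ (c : C) (w w' : Fin k → F), c = f ((extChartAt 𝓘(ℝ, E) x₀).symm y) → w = w' →
      (show F [⋀^Fin k]→L[ℝ] ℝ from η (f ((extChartAt 𝓘(ℝ, E) x₀).symm y))) w' =
        (show F [⋀^Fin k]→L[ℝ] ℝ from η c) w := by
    rintro c w w' rfl rfl; rfl
  ext v
  refine h _ _ _ ((extChartAt 𝓘(ℝ, F) c₀).left_inv hc) ?_
  ext i
  change mfderiv 𝓘(ℝ, F) 𝓘(ℝ, F) (extChartAt 𝓘(ℝ, F) c₀).symm _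
    (fderiv ℝ (chartRep E F f x₀ c₀) y (v i)) = _
  rw [fderiv_chartRep hy hc hf]
  have hP : chartRep E F f x₀ c₀ y ∈ (extChartAt 𝓘(ℝ, F) c₀).target :=
    (extChartAt 𝓘(ℝ, F) c₀).map_source hc
  have h2 : ∀ (c : C) (w : F), c = (extChartAt 𝓘(ℝ, F) c₀).symm (chartRep E F f x₀ c₀ y) →
      mfderiv 𝓘(ℝ, F) 𝓘(ℝ, F) (extChartAt 𝓘(ℝ, F) c₀).symm (chartRep E F f x₀ c₀ y)
        (mfderiv 𝓘(ℝ, F) 𝓘(ℝ, F) (extChartAt 𝓘(ℝ, F) c₀) c w) = w := by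
    rintro c w rfl
    exact mfderiv_symm_mfderiv_extChartAt hP w
  exact h2 _ _ ((extChartAt 𝓘(ℝ, F) c₀).left_inv hc).symm

/-- The exterior derivative commutes with pullback. -/
theorem DForm.d_pullback {k : ℕ} {f : M → C} {η : DForm F C k} (x : M)
    (hη : DifferentiableAt ℝ (η.inChart (f x)) (extChartAt 𝓘(ℝ, F) (f x) (f x)))
    (hf : ContMDiff 𝓘(ℝ, E) 𝓘(ℝ, F) ∞ f) (v : Fin (k + 1) → TangentSpace 𝓘(ℝ, E) x) :
    (DForm.pullback f η).d x v =
      η.d (f x) (fun i ↦ mfderiv 𝓘(ℝ, E) 𝓘(ℝ, F) f x (v i)) := by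
  have hx := mem_extChartAt_target (I := 𝓘(ℝ, E)) x
  have hsrc : ∀ᶠ m in 𝓝 ((extChartAt 𝓘(ℝ, E) x).symm (extChartAt 𝓘(ℝ, E) x x)),
      f m ∈ (extChartAt 𝓘(ℝ, F) (f x)).source := by
    rw [extChartAt_to_inv]
    exact hf.continuous.continuousAt.eventually (extChartAt_source_mem_nhds (f x))
  have hev : (DForm.pullback (E := E) f η).inChart x =ᶠ[𝓝 (extChartAt 𝓘(ℝ, E) x x)]
      fun y ↦ (η.inChart (f x) (chartRep E F f x (f x) y)).compContinuousLinearMap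
        (fderiv ℝ (chartRep E F f x (f x)) y) := by
    filter_upwards [eventually_mem_target hx, eventually_extChartAt_symm hx hsrc] with y hy hc
    exact DForm.inChart_pullback η hy hc (hf.mdifferentiableAt (by simp))
  have hP0 : chartRep E F f x (f x) (extChartAt 𝓘(ℝ, E) x x) = extChartAt 𝓘(ℝ, F) (f x) (f x) := by
    simp [chartRep]
  have hP : ContDiffAt ℝ ∞ (chartRep E F f x (f x)) (extChartAt 𝓘(ℝ, E) x x) :=
    contDiffAt_chartRep hx (by simp) hf.contMDiffAt
  rw [DForm.d_eq, DForm.d_eq, hev.extDeriv_eq,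
    extDeriv_pullback (r := ∞) (by rw [hP0]; exact hη) hP minSmoothness_two_le_infty, hP0]
  change extDeriv _ _ _ = extDeriv _ _ _
  congr 1
  ext i
  exact fderiv_chartRep_self (hf.mdifferentiableAt (by simp)) (v i)

/-! ### Interior products and smoothness in charts -/

theorem DForm.inChart_apply_inChart {V : VField E M} {Ω : DForm E M 2} {x₀ : M} {y : E}
    (hy : y ∈ (extChartAt 𝓘(ℝ, E) x₀).target) (v : E) :
    Ω.inChart x₀ y ![V.inChart x₀ y, v] =
      Ω ((extChartAt 𝓘(ℝ, E) x₀).symm y) ![V ((extChartAt 𝓘(ℝ, E) x₀).symm y),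
        mfderiv 𝓘(ℝ, E) 𝓘(ℝ, E) (extChartAt 𝓘(ℝ, E) x₀).symm y v] := by
  change (Ω ((extChartAt 𝓘(ℝ, E) x₀).symm y)) _ = _
  congr 1
  ext i
  fin_cases i
  · exact mfderiv_symm_mfderiv_extChartAt hy _
  · rfl

theorem DForm.inChart_smul_interior (V : VField E M) (Ω : DForm E M 2) (r : M → ℝ) {x₀ : M}
    {y : E} (hy : y ∈ (extChartAt 𝓘(ℝ, E) x₀).target) :
    DForm.inChart (fun m ↦ (r m)⁻¹ • Ω.interior V m) x₀ y =
      (r ((extChartAt 𝓘(ℝ, E) x₀).symm y))⁻¹ • (Ω.inChart x₀ y).curryLeft (V.inChart x₀ y) := by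
  apply oneForm_ext
  intro v
  have h : (Ω.inChart x₀ y).curryLeft (V.inChart x₀ y) ![v] =
      Ω.inChart x₀ y ![V.inChart x₀ y, v] := rfl
  rw [ContinuousAlternatingMap.smul_apply, h, DForm.inChart_apply_inChart hy]
  change (r _)⁻¹ • (Ω ((extChartAt 𝓘(ℝ, E) x₀).symm y)) _ = _
  congr 2
  ext i
  fin_cases i <;> rfl

/-- Smoothness of a vector field near `p` can be read off in any one chart around `p`. -/
theorem contMDiffAt_vField_iff {V : VField E M} {x₀ p : M} (hp : p ∈ (chartAt E x₀).source) :
    ContMDiffAt 𝓘(ℝ, E) 𝓘(ℝ, E).tangent ∞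
        (fun x ↦ (⟨x, V x⟩ : TangentBundle 𝓘(ℝ, E) M)) p ↔
      ContMDiffAt 𝓘(ℝ, E) 𝓘(ℝ, E) ∞
        (fun m ↦ (mfderiv 𝓘(ℝ, E) 𝓘(ℝ, E) (extChartAt 𝓘(ℝ, E) x₀) m (V m) : E)) p := by
  have hb : ∀ {q : M}, q ∈ (chartAt E x₀).source →
      q ∈ (trivializationAt E (TangentSpace 𝓘(ℝ, E)) x₀).baseSet := by
    intro q hq
    rwa [TangentBundle.trivializationAt_baseSet]
  refine ((trivializationAt E (TangentSpace 𝓘(ℝ, E)) x₀).contMDiffAt_section_iff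
    (hb hp)).trans (Filter.EventuallyEq.contMDiffAt_iff ?_)
  filter_upwards [(chartAt E x₀).open_source.mem_nhds hp] with q hq
  rw [← TangentBundle.continuousLinearMapAt_trivializationAt hq]
  exact (Bundle.Trivialization.continuousLinearMapAt_apply_of_mem (R := ℝ) _ (hb hq) _).symm

theorem VField.SmoothOn.contDiffAt_inChart {V : VField E M} {U : Set M} (hV : V.SmoothOn U)
    {x₀ : M} {y : E} (hy : y ∈ (extChartAt 𝓘(ℝ, E) x₀).target)
    (hyU : U ∈ 𝓝 ((extChartAt 𝓘(ℝ, E) x₀).symm y)) : ContDiffAt ℝ ∞ (V.inChart x₀) y := by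
  have h1 := (contMDiffAt_vField_iff (by
    rw [← extChartAt_source 𝓘(ℝ, E)]; exact (extChartAt 𝓘(ℝ, E) x₀).map_target hy)).1
      (hV.contMDiffAt hyU)
  exact (h1.comp y (contMDiffAt_extChartAt_symm hy)).contDiffAt

theorem contMDiffAt_vField_of_contDiffAt_inChart {V : VField E M} {x : M}
    (hV : ContDiffAt ℝ ∞ (V.inChart x) (extChartAt 𝓘(ℝ, E) x x)) :
    ContMDiffAt 𝓘(ℝ, E) 𝓘(ℝ, E).tangent ∞
      (fun x ↦ (⟨x, V x⟩ : TangentBundle 𝓘(ℝ, E) M)) x := by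
  rw [contMDiffAt_vField_iff (mem_chart_source E x)]
  refine (hV.contMDiffAt.comp x contMDiffAt_extChartAt).congr_of_eventuallyEq ?_
  filter_upwards [extChartAt_source_mem_nhds (I := 𝓘(ℝ, E)) x] with q hq
  have h : ∀ q' : M, q' = q →
      (mfderiv 𝓘(ℝ, E) 𝓘(ℝ, E) (extChartAt 𝓘(ℝ, E) x) q (V q) : E) =
        mfderiv 𝓘(ℝ, E) 𝓘(ℝ, E) (extChartAt 𝓘(ℝ, E) x) q' (V q') := by
    rintro q' rfl; rfl
  exact h _ ((extChartAt 𝓘(ℝ, E) x).left_inv hq)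

end Charts

section Quotient

variable {E : Type*} [NormedAddCommGroup E] [NormedSpace ℝ E] [FiniteDimensional ℝ E]
  {M : Type*} [TopologicalSpace M] [T2Space M] [ChartedSpace E M] [IsManifold 𝓘(ℝ, E) ∞ M]
  {F : Type*} [NormedAddCommGroup F] [NormedSpace ℝ F] [FiniteDimensional ℝ F]
  {C : Type*} [TopologicalSpace C] [ChartedSpace F C] [IsManifold 𝓘(ℝ, F) ∞ C]
  {D : VField E M} {π : M → C} {ρ : M → ℝ} {Ω : DForm E M 2}

/-! ### The fibres of the orbit projection -/

/-- The symmetry is tangent to the fibres: `π` is constant along its integral curves. -/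
theorem IsOrbitSpace.mfderiv_vField (hπ : IsOrbitSpace (F := F) D π)
    (hD : D.SmoothOn Set.univ) (m : M) : mfderiv 𝓘(ℝ, E) 𝓘(ℝ, F) π m (D m) = 0 := by
  have := FiniteDimensional.complete ℝ E
  obtain ⟨γ, hγ0, hγ⟩ := exists_isMIntegralCurveAt_of_contMDiffAt_boundaryless (I := 𝓘(ℝ, E)) 0
    ((hD.contMDiffAt (x := m) univ_mem).of_le (by simp : (1 : WithTop ℕ∞) ≤ ∞))
  obtain ⟨ε, hε, hγε⟩ := isMIntegralCurveAt_iff'.1 hγ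
  subst hγ0
  have hconst : (fun t ↦ π (γ t)) =ᶠ[𝓝 0] fun _ ↦ π (γ 0) := by
    filter_upwards [Metric.ball_mem_nhds (0 : ℝ) hε] with t ht
    rw [hπ.fibers]
    exact ⟨γ, Metric.ball 0 ε, Metric.isOpen_ball, (convex_ball 0 ε).ordConnected, hγε,
      ⟨t, ht, rfl⟩, ⟨0, Metric.mem_ball_self hε, rfl⟩⟩
  have hd : HasMFDerivAt 𝓘(ℝ, E) 𝓘(ℝ, F) π (γ 0) (mfderiv 𝓘(ℝ, E) 𝓘(ℝ, F) π (γ 0)) :=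
    (hπ.smooth.mdifferentiableAt (by simp)).hasMFDerivAt
  have h1 := hd.comp (0 : ℝ) hγ.hasMFDerivAt
  have h2 := (hasMFDerivAt_const (I := 𝓘(ℝ, ℝ)) (I' := 𝓘(ℝ, F)) (π (γ 0))
    (0 : ℝ)).congr_of_eventuallyEq hconst
  have h3 := hasMFDerivAt_unique h1 h2
  have h4 := congrArg (fun L : ℝ →L[ℝ] F ↦ L 1) h3
  have h5 : mfderiv 𝓘(ℝ, E) 𝓘(ℝ, F) π (γ 0) ((1 : ℝ) • D (γ 0)) = 0 := h4
  rwa [one_smul] at h5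

theorem IsScalingFunction.vField_ne_zero (hρ : IsScalingFunction D ρ) (m : M) : D m ≠ 0 := by
  intro h
  have := hρ.scaling m
  rw [lieDerivFun, h, map_zero] at this
  exact hρ.ne_zero m this.symm

/-- The fibres of `π` are one-dimensional, so the kernel of its differential is spanned by `D`,
which has no zeros because `L_D ρ = ρ ≠ 0`. -/
theorem IsOrbitSpace.exists_eq_smul (hπ : IsOrbitSpace (F := F) D π)
    (hD : D.SmoothOn Set.univ) (hρ : IsScalingFunction D ρ)
    (hdim : Module.finrank ℝ E = Module.finrank ℝ F + 1) (m : M)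
    (u : TangentSpace 𝓘(ℝ, E) m) (hu : mfderiv 𝓘(ℝ, E) 𝓘(ℝ, F) π m u = 0) :
    ∃ c : ℝ, u = c • D m := by
  let L : E →ₗ[ℝ] F := (mfderiv 𝓘(ℝ, E) 𝓘(ℝ, F) π m).toLinearMap
  have hL : LinearMap.range L = ⊤ := LinearMap.range_eq_top.2 (hπ.submersion m)
  have h1 := L.finrank_range_add_finrank_ker
  rw [hL, finrank_top, hdim] at h1
  have h2 : Module.finrank ℝ (LinearMap.ker L) = 1 := by omega
  have h3 : (⟨D m, hπ.mfderiv_vField hD m⟩ : LinearMap.ker L) ≠ 0 := by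
    intro h
    exact hρ.vField_ne_zero m (congrArg Subtype.val h)
  obtain ⟨c, hc⟩ := (finrank_eq_one_iff_of_nonzero' _ h3).1 h2 ⟨u, hu⟩
  exact ⟨c, (congrArg Subtype.val hc).symm⟩

/-- A function whose derivative along every integral curve of `D` vanishes is constant on the
orbits of `D`. Only curves inside a fibre of `π` need to be tested. -/
theorem IsOrbitSpace.eq_of_hasDerivAt_zero (hπ : IsOrbitSpace (F := F) D π) {g : M → ℝ}
    (hg : ∀ (γ : ℝ → M) (t : ℝ),
      HasMFDerivAt 𝓘(ℝ, ℝ) 𝓘(ℝ, E) γ t ((1 : ℝ →L[ℝ] ℝ).smulRight (D (γ t))) →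
      (∀ᶠ s in 𝓝 t, π (γ s) = π (γ t)) → HasDerivAt (fun s ↦ g (γ s)) 0 t)
    {m m' : M} (h : π m = π m') : g m = g m' := by
  obtain ⟨γ, s, hs, hsc, hγ, ⟨a, ha, rfl⟩, ⟨b, hb, rfl⟩⟩ := (hπ.fibers m m').1 h
  have hder : ∀ t ∈ s, HasDerivAt (fun s ↦ g (γ s)) 0 t := by
    intro t ht
    refine hg γ t ((hγ t ht).hasMFDerivAt (hs.mem_nhds ht)) ?_
    filter_upwards [hs.mem_nhds ht] with r hr
    exact (hπ.fibers _ _).2 ⟨γ, s, hs, hsc, hγ, ⟨r, hr, rfl⟩, ⟨t, ht, rfl⟩⟩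
  exact hs.is_const_of_deriv_eq_zero hsc.isPreconnected
    (fun t ht ↦ (hder t ht).differentiableAt.differentiableWithinAt)
    (fun t ht ↦ (hder t ht).deriv) ha hb

theorem hasDerivAt_comp_integralCurve {G : Type*} [NormedAddCommGroup G] [NormedSpace ℝ G]
    {g : M → G} {γ : ℝ → M} {t : ℝ}
    (hg : MDifferentiableAt 𝓘(ℝ, E) 𝓘(ℝ, G) g (γ t))
    (hγ : HasMFDerivAt 𝓘(ℝ, ℝ) 𝓘(ℝ, E) γ t ((1 : ℝ →L[ℝ] ℝ).smulRight (D (γ t)))) :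
    HasDerivAt (fun s ↦ g (γ s)) (mfderiv 𝓘(ℝ, E) 𝓘(ℝ, G) g (γ t) (D (γ t))) t := by
  have h := hg.hasMFDerivAt.comp t hγ
  have h1 : DifferentiableAt ℝ (fun s ↦ g (γ s)) t :=
    mdifferentiableAt_iff_differentiableAt.1 h.mdifferentiableAt
  have h2 : fderiv ℝ (fun s ↦ g (γ s)) t 1 =
      mfderiv 𝓘(ℝ, E) 𝓘(ℝ, G) g (γ t) (D (γ t)) := by
    rw [← mfderiv_eq_fderiv]
    refine (congrArg (fun L : ℝ →L[ℝ] G ↦ L 1) h.mfderiv).trans ?_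
    change mfderiv 𝓘(ℝ, E) 𝓘(ℝ, G) g (γ t) ((1 : ℝ) • D (γ t)) = _
    rw [one_smul]
  exact h2 ▸ h1.hasFDerivAt.hasDerivAt

/-! ### The reduced 1-form -/

theorem DForm.lieEqSelfAt (hlie : ∀ x v, Ω.lieDeriv D x v = Ω x v) (m : M) :
    LieEqSelfAt (D.inChart m) (Ω.inChart m) (extChartAt 𝓘(ℝ, E) m m) := by
  refine LieEqSelfAt.of_coordinates (mfderiv_extChartAt_self_apply m) fun v ↦ ?_
  refine (hlie m v).trans ?_
  rw [DForm.inChart_self]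
  rfl

/-- `(i_D Ω / ρ)(u)` only depends on the projection of `u`. -/
theorem IsOrbitSpace.interior_congr (hπ : IsOrbitSpace (F := F) D π)
    (hD : D.SmoothOn Set.univ) (hρ : IsScalingFunction D ρ)
    (hdim : Module.finrank ℝ E = Module.finrank ℝ F + 1) {m : M}
    {u u' : TangentSpace 𝓘(ℝ, E) m}
    (h : mfderiv 𝓘(ℝ, E) 𝓘(ℝ, F) π m u = mfderiv 𝓘(ℝ, E) 𝓘(ℝ, F) π m u') :
    Ω m ![D m, u] = Ω m ![D m, u'] := by
  obtain ⟨c, hc⟩ := hπ.exists_eq_smul hD hρ hdim m (u - u') (by rw [map_sub, h, sub_self])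
  exact twoForm_congr_of_sub_eq_smul (E := E) (Ω m) hc

/-- For a fixed tangent vector `v` of the orbit space, the value of `i_D Ω / ρ` on lifts `R m v` of
`v` is constant along the integral curves of `D`. The lifts need not depend smoothly on the point:
only their projection matters, so near `γ t` they can be replaced by a smooth local lift `W`. -/
theorem IsOrbitSpace.hasDerivAt_lift (hπ : IsOrbitSpace (F := F) D π)
    (hΩ : Ω.Smooth) (hD : D.SmoothOn Set.univ) (hlie : ∀ x v, Ω.lieDeriv D x v = Ω x v)
    (hρ : IsScalingFunction D ρ) (hdim : Module.finrank ℝ E = Module.finrank ℝ F + 1)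
    {R : M → F → E} (hR : ∀ m v, mfderiv 𝓘(ℝ, E) 𝓘(ℝ, F) π m (R m v) = v) (v : F)
    (γ : ℝ → M) (t : ℝ)
    (hγ : HasMFDerivAt 𝓘(ℝ, ℝ) 𝓘(ℝ, E) γ t ((1 : ℝ →L[ℝ] ℝ).smulRight (D (γ t))))
    (hconst : ∀ᶠ s in 𝓝 t, π (γ s) = π (γ t)) :
    HasDerivAt (fun s ↦ (ρ (γ s))⁻¹ * Ω (γ s) ![D (γ s), R (γ s) v]) 0 t := by
  set m := γ t with hm
  set y := extChartAt 𝓘(ℝ, E) m m with hy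
  have hyt : y ∈ (extChartAt 𝓘(ℝ, E) m).target := mem_extChartAt_target m
  have hys : (extChartAt 𝓘(ℝ, E) m).symm y = m := extChartAt_to_inv m
  set P := chartRep E F π m (π m) with hPdef
  have hsrc : ∀ᶠ z in 𝓝 y, π ((extChartAt 𝓘(ℝ, E) m).symm z) ∈
      (extChartAt 𝓘(ℝ, F) (π m)).source := by
    refine eventually_extChartAt_symm hyt (p := fun q ↦ π q ∈ _) ?_
    rw [hys]
    exact hπ.smooth.continuous.continuousAt.eventually (extChartAt_source_mem_nhds (π m))
  have hP : ContDiffAt ℝ ∞ P y :=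
    contDiffAt_chartRep hyt (by rw [hys]; exact mem_extChartAt_source _) hπ.smooth.contMDiffAt
  have hP2 : ContDiffAt ℝ 2 P y :=
    hP.of_le (WithTop.coe_le_coe.2 (le_top : (2 : ℕ∞) ≤ ⊤))
  have hπd : ∀ q, MDifferentiableAt 𝓘(ℝ, E) 𝓘(ℝ, F) π q :=
    fun q ↦ hπ.smooth.mdifferentiableAt (by simp)
  have hfP : ∀ w : E, fderiv ℝ P y w = mfderiv 𝓘(ℝ, E) 𝓘(ℝ, F) π m w :=
    fun w ↦ fderiv_chartRep_self (hπd m) w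
  have hPs : Function.Surjective (fderiv ℝ P y) := by
    intro w
    obtain ⟨u, hu⟩ := hπ.submersion m w
    exact ⟨u, (hfP u).trans hu⟩
  obtain ⟨W, hW, hPW⟩ := exists_lift_vector hP2 hPs v
  set r : E → ℝ := fun z ↦ ρ ((extChartAt 𝓘(ℝ, E) m).symm z) with hr
  have hρd : MDifferentiableAt 𝓘(ℝ, E) 𝓘(ℝ, ℝ) ρ m := hρ.smooth.mdifferentiableAt (by simp)
  have hrd : DifferentiableAt ℝ r y := by
    have h1 : ContMDiffAt 𝓘(ℝ, E) 𝓘(ℝ, ℝ) ∞ r y :=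
      hρ.smooth.contMDiffAt.comp y (contMDiffAt_extChartAt_symm hyt)
    exact h1.contDiffAt.differentiableAt (by simp)
  have hr0 : r y ≠ 0 := hρ.ne_zero _
  have hDc : ContDiffAt ℝ ∞ (D.inChart m) y := hD.contDiffAt_inChart hyt univ_mem
  have hDy : D.inChart m y = D m := VField.inChart_self D m
  have hΩc : ContDiffAt ℝ ∞ (Ω.inChart m) y :=
    (hΩ m).contDiffAt ((isOpen_extChartAt_target m).mem_nhds hyt)
  have hrD : fderiv ℝ r y (D.inChart m y) = r y := by
    rw [hDy]
    refine (fderiv_comp_extChartAt_symm_self hρd (D m)).trans ?_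
    refine (hρ.scaling m).trans ?_
    rw [hr]; dsimp only; rw [hys]
  have hPD : ∀ᶠ z in 𝓝 y, fderiv ℝ P z (D.inChart m z) = 0 := by
    filter_upwards [eventually_mem_target hyt, hsrc] with z hz hc
    rw [hPdef, fderiv_chartRep hz hc (hπd _), VField.inChart, mfderiv_symm_mfderiv_extChartAt hz,
      hπ.mfderiv_vField hD]
    exact map_zero _
  have hkey := fderiv_lift_eq_zero (hΩc.differentiableAt (by simp)) (hDc.differentiableAt (by simp))
    hW hrd hr0 hP2 (DForm.lieEqSelfAt hlie m) hrD hPD hPW (fun u hu ↦ by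
      rw [hDy]
      exact hπ.exists_eq_smul hD hρ hdim m u ((hfP u).symm.trans hu))
  have hgd : DifferentiableAt ℝ
      (fun z ↦ (r z)⁻¹ * Ω.inChart m z ![D.inChart m z, W z]) y := by
    refine (hrd.fun_inv hr0).fun_mul ?_
    refine (hΩc.differentiableAt (by simp)).continuousAlternatingMap_apply
      (g := fun i z ↦ (![D.inChart m z, W z] : Fin 2 → E) i) ?_
    intro i
    fin_cases i
    · exact hDc.differentiableAt (by simp)
    · exact hW
  have hcurve : HasDerivAt (fun s ↦ extChartAt 𝓘(ℝ, E) m (γ s)) (D.inChart m y) t := by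
    have h1 := hasDerivAt_comp_integralCurve (D := D) (g := extChartAt 𝓘(ℝ, E) m)
      (mdifferentiableAt_extChartAt (mem_chart_source E m)) hγ
    rw [hDy]
    have h2 := mfderiv_extChartAt_self_apply m (D m)
    exact h2 ▸ h1
  have hcomp := (HasFDerivAt.comp_hasDerivAt t (f := fun s ↦ extChartAt 𝓘(ℝ, E) m (γ s))
    (l := fun z ↦ (r z)⁻¹ * Ω.inChart m z ![D.inChart m z, W z]) hgd.hasFDerivAt hcurve)
  rw [hkey] at hcomp
  refine hcomp.congr_of_eventuallyEq ?_
  have hγc : ContinuousAt γ t := hγ.continuousAt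
  have hyc : ContinuousAt (fun s ↦ extChartAt 𝓘(ℝ, E) m (γ s)) t := hcurve.continuousAt
  filter_upwards [hconst, hγc.eventually (extChartAt_source_mem_nhds (I := 𝓘(ℝ, E)) m),
    hyc.eventually hPW, hyc.eventually hsrc] with s hs1 hs2 hs3 hs4
  have hz : extChartAt 𝓘(ℝ, E) m (γ s) ∈ (extChartAt 𝓘(ℝ, E) m).target :=
    (extChartAt 𝓘(ℝ, E) m).map_source hs2
  have hinv : (extChartAt 𝓘(ℝ, E) m).symm (extChartAt 𝓘(ℝ, E) m (γ s)) = γ s :=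
    (extChartAt 𝓘(ℝ, E) m).left_inv hs2
  change _ = (r (extChartAt 𝓘(ℝ, E) m (γ s)))⁻¹ * Ω.inChart m (extChartAt 𝓘(ℝ, E) m (γ s))
    ![D.inChart m (extChartAt 𝓘(ℝ, E) m (γ s)), W (extChartAt 𝓘(ℝ, E) m (γ s))]
  rw [DForm.inChart_apply_inChart hz, hr]
  rw [hPdef, fderiv_chartRep hz hs4 (hπd _)] at hs3
  -- The lift `W` lives over the point `φ⁻¹ (φ (γ s))`, which is to be replaced by `γ s`.
  generalize mfderiv 𝓘(ℝ, E) 𝓘(ℝ, E) (extChartAt 𝓘(ℝ, E) m).symm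
    (extChartAt 𝓘(ℝ, E) m (γ s)) (W (extChartAt 𝓘(ℝ, E) m (γ s))) = w at hs3 ⊢
  dsimp only
  revert w
  rw [hinv, hs1]
  intro w hw
  rw [mfderiv_extChartAt_self_apply] at hw
  rw [hπ.interior_congr (Ω := Ω) hD hρ hdim ((hR (γ s) v).trans hw.symm)]

/-- A 1-form is determined by its pullback along a surjective submersion. -/
theorem IsOrbitSpace.pullback_injective (hπ : IsOrbitSpace (F := F) D π) {η η' : DForm F C 1}
    (h : DForm.pullback (E := E) π η = DForm.pullback π η') : η = η' := by
  funext c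
  obtain ⟨m, rfl⟩ := hπ.surjective c
  refine oneForm_ext (E := F) fun v ↦ ?_
  obtain ⟨u, rfl⟩ := hπ.submersion m v
  have h1 := congrArg (fun α : E [⋀^Fin 1]→L[ℝ] ℝ ↦ α ![u]) (congrFun h m)
  have h2 : ∀ ζ : DForm F C 1, (show E [⋀^Fin 1]→L[ℝ] ℝ from DForm.pullback (E := E) π ζ m) ![u] =
      (show F [⋀^Fin 1]→L[ℝ] ℝ from ζ (π m)) ![mfderiv 𝓘(ℝ, E) 𝓘(ℝ, F) π m u] := by
    intro ζ
    refine congrArg (show F [⋀^Fin 1]→L[ℝ] ℝ from ζ (π m)) ?_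
    ext i; fin_cases i; rfl
  exact (h2 η).symm.trans (h1.trans (h2 η'))

/-- The 1-form `i_D Ω / ρ` descends to the orbit space. -/
theorem IsOrbitSpace.exists_pullback_eq (hπ : IsOrbitSpace (F := F) D π)
    (hΩ : Ω.Smooth) (hD : D.SmoothOn Set.univ) (hlie : ∀ x v, Ω.lieDeriv D x v = Ω x v)
    (hρ : IsScalingFunction D ρ) (hdim : Module.finrank ℝ E = Module.finrank ℝ F + 1) :
    ∃ η : DForm F C 1, DForm.pullback π η = fun m ↦ (ρ m)⁻¹ • Ω.interior D m := by
  have hex : ∀ m, ∃ R : F →L[ℝ] E, ∀ v, mfderiv 𝓘(ℝ, E) 𝓘(ℝ, F) π m (R v) = v := by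
    intro m
    let L : E →L[ℝ] F := mfderiv 𝓘(ℝ, E) 𝓘(ℝ, F) π m
    obtain ⟨R, hR⟩ := L.exists_rightInverse_of_surjective
      (LinearMap.range_eq_top.2 (hπ.submersion m))
    exact ⟨R, fun v ↦ congrArg (fun T : F →L[ℝ] F ↦ T v) hR⟩
  choose R hR using hex
  -- The value of the reduced form at `c` is computed on arbitrary lifts at an arbitrary point `s c`
  -- of the fibre; the choice does not matter.
  choose s hs using hπ.surjective
  refine ⟨fun c ↦ (show E [⋀^Fin 1]→L[ℝ] ℝ from (ρ (s c))⁻¹ •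
    Ω.interior D (s c)).compContinuousLinearMap (R (s c)), ?_⟩
  funext m
  refine oneForm_ext (E := E) fun u ↦ ?_
  have hint : ∀ (q : M) (w : E), (show E [⋀^Fin 1]→L[ℝ] ℝ from (ρ q)⁻¹ • Ω.interior D q) ![w] =
      (ρ q)⁻¹ * Ω q ![D q, w] := fun q w ↦ rfl
  let v : F := mfderiv 𝓘(ℝ, E) 𝓘(ℝ, F) π m u
  have h1 : (ρ (s (π m)))⁻¹ * Ω (s (π m)) ![D (s (π m)), R (s (π m)) v] =
      (ρ m)⁻¹ * Ω m ![D m, R m v] :=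
    hπ.eq_of_hasDerivAt_zero (g := fun q ↦ (ρ q)⁻¹ * Ω q ![D q, R q v])
      (fun γ t hγ hc ↦ hπ.hasDerivAt_lift hΩ hD hlie hρ hdim (R := fun q v ↦ R q v) hR v γ t hγ hc)
      (hs (π m))
  have h2 : Ω m ![D m, R m v] = Ω m ![D m, u] :=
    hπ.interior_congr hD hρ hdim (hR m v)
  rw [h2, ← hint, ← hint] at h1
  refine Eq.trans ?_ h1
  refine congrArg (show E [⋀^Fin 1]→L[ℝ] ℝ from (ρ (s (π m)))⁻¹ • Ω.interior D (s (π m))) ?_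
  ext i; fin_cases i; rfl

/-! ### Local sections and smoothness on the orbit space -/

/-- Through every point of `M` there is a smooth local section of `π`. -/
theorem IsOrbitSpace.exists_section (hπ : IsOrbitSpace (F := F) D π) (m : M) :
    ∃ σ : C → M, ContMDiffAt 𝓘(ℝ, F) 𝓘(ℝ, E) ∞ σ (π m) ∧ σ (π m) = m ∧
      ∀ᶠ c in 𝓝 (π m), π (σ c) = c := by
  have hy := mem_extChartAt_target (I := 𝓘(ℝ, E)) m
  have hys : (extChartAt 𝓘(ℝ, E) m).symm (extChartAt 𝓘(ℝ, E) m m) = m := extChartAt_to_inv m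
  have hP : ContDiffAt ℝ ∞ (chartRep E F π m (π m)) (extChartAt 𝓘(ℝ, E) m m) :=
    contDiffAt_chartRep hy (by rw [hys]; exact mem_extChartAt_source _) hπ.smooth.contMDiffAt
  have hPs : Function.Surjective (fderiv ℝ (chartRep E F π m (π m)) (extChartAt 𝓘(ℝ, E) m m)) := by
    intro w
    obtain ⟨u, hu⟩ := hπ.submersion m w
    exact ⟨u, (fderiv_chartRep_self (hπ.smooth.mdifferentiableAt (by simp)) u).trans hu⟩
  obtain ⟨τ, hτ, hτ0, hτs⟩ := exists_local_section hP hPs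
  have hP0 : chartRep E F π m (π m) (extChartAt 𝓘(ℝ, E) m m) = extChartAt 𝓘(ℝ, F) (π m) (π m) := by
    simp [chartRep]
  rw [hP0] at hτ hτ0 hτs
  have hψ : ContMDiffAt 𝓘(ℝ, F) 𝓘(ℝ, F) ∞ (extChartAt 𝓘(ℝ, F) (π m)) (π m) := contMDiffAt_extChartAt
  have hτψ : ContMDiffAt 𝓘(ℝ, F) 𝓘(ℝ, E) ∞ (fun c ↦ τ (extChartAt 𝓘(ℝ, F) (π m) c)) (π m) :=
    hτ.contMDiffAt.comp (π m) hψ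
  have hφ : ContMDiffAt 𝓘(ℝ, E) 𝓘(ℝ, E) ∞ (extChartAt 𝓘(ℝ, E) m).symm
      (τ (extChartAt 𝓘(ℝ, F) (π m) (π m))) := by
    rw [hτ0]; exact contMDiffAt_extChartAt_symm hy
  have hσ : ContMDiffAt 𝓘(ℝ, F) 𝓘(ℝ, E) ∞
      (fun c ↦ (extChartAt 𝓘(ℝ, E) m).symm (τ (extChartAt 𝓘(ℝ, F) (π m) c))) (π m) :=
    hφ.comp (π m) hτψ
  have h0 : (extChartAt 𝓘(ℝ, E) m).symm (τ (extChartAt 𝓘(ℝ, F) (π m) (π m))) = m := by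
    rw [hτ0, hys]
  refine ⟨_, hσ, h0, ?_⟩
  have hsrc : ∀ᶠ c in 𝓝 (π m), π ((extChartAt 𝓘(ℝ, E) m).symm (τ (extChartAt 𝓘(ℝ, F) (π m) c))) ∈
      (extChartAt 𝓘(ℝ, F) (π m)).source := by
    have hcont : ContinuousAt (fun c ↦ π ((extChartAt 𝓘(ℝ, E) m).symm
        (τ (extChartAt 𝓘(ℝ, F) (π m) c)))) (π m) :=
      hπ.smooth.continuous.continuousAt.comp hσ.continuousAt
    refine hcont.eventually_mem ?_
    rw [h0]
    exact extChartAt_source_mem_nhds (π m)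
  filter_upwards [hψ.continuousAt.eventually hτs, hsrc,
    extChartAt_source_mem_nhds (I := 𝓘(ℝ, F)) (π m)] with c hc hc1 hc2
  exact (extChartAt 𝓘(ℝ, F) (π m)).injOn hc1 hc2 hc

theorem IsOrbitSpace.contMDiffAt_of_comp {G : Type*} [NormedAddCommGroup G] [NormedSpace ℝ G]
    (hπ : IsOrbitSpace (F := F) D π) {h : C → G} {m : M}
    (hh : ContMDiffAt 𝓘(ℝ, E) 𝓘(ℝ, G) ∞ (fun q ↦ h (π q)) m) :
    ContMDiffAt 𝓘(ℝ, F) 𝓘(ℝ, G) ∞ h (π m) := by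
  obtain ⟨σ, hσ, h0, hs⟩ := hπ.exists_section m
  have h1 : ContMDiffAt 𝓘(ℝ, E) 𝓘(ℝ, G) ∞ (fun q ↦ h (π q)) (σ (π m)) := by rwa [h0]
  refine (h1.comp (π m) hσ).congr_of_eventuallyEq ?_
  filter_upwards [hs] with c hc
  simp [hc]

/-- The projection of a smooth vector field is smooth wherever it is well defined, since it can be
computed along a smooth local section. -/
theorem IsOrbitSpace.contMDiffAt_vField_of_projection (hπ : IsOrbitSpace (F := F) D π)
    {X : VField E M} {Y : VField F C} {m : M}
    (hX : ContMDiffAt 𝓘(ℝ, E) 𝓘(ℝ, E).tangent ∞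
      (fun x ↦ (⟨x, X x⟩ : TangentBundle 𝓘(ℝ, E) M)) m)
    (hXY : ∀ᶠ q in 𝓝 m, mfderiv 𝓘(ℝ, E) 𝓘(ℝ, F) π q (X q) = Y (π q)) :
    ContMDiffAt 𝓘(ℝ, F) 𝓘(ℝ, F).tangent ∞
      (fun x ↦ (⟨x, Y x⟩ : TangentBundle 𝓘(ℝ, F) C)) (π m) := by
  obtain ⟨σ, hσ, h0, hs⟩ := hπ.exists_section m
  have h1 : ContMDiffAt 𝓘(ℝ, E) 𝓘(ℝ, E).tangent ∞
      (fun x ↦ (⟨x, X x⟩ : TangentBundle 𝓘(ℝ, E) M)) (σ (π m)) := by rwa [h0]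
  have h2 : ContMDiff 𝓘(ℝ, E).tangent 𝓘(ℝ, F).tangent ∞ (tangentMap 𝓘(ℝ, E) 𝓘(ℝ, F) π) :=
    hπ.smooth.contMDiff_tangentMap (by simp)
  have h3 := h2.contMDiffAt.comp (π m) (h1.comp (π m) hσ)
  refine h3.congr_of_eventuallyEq ?_
  have hev : ∀ᶠ c in 𝓝 (π m),
      mfderiv 𝓘(ℝ, E) 𝓘(ℝ, F) π (σ c) (X (σ c)) = Y (π (σ c)) := by
    refine hσ.continuousAt.eventually
      (p := fun q ↦ mfderiv 𝓘(ℝ, E) 𝓘(ℝ, F) π q (X q) = Y (π q)) ?_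
    rwa [h0]
  filter_upwards [hs, hev] with c hc hc'
  change (⟨c, Y c⟩ : TangentBundle 𝓘(ℝ, F) C) =
    ⟨π (σ c), mfderiv 𝓘(ℝ, E) 𝓘(ℝ, F) π (σ c) (X (σ c))⟩
  rw [hc', hc]

theorem compContinuousLinearMap_oneForm (a : E [⋀^Fin 1]→L[ℝ] ℝ) (L : F →L[ℝ] E) :
    a.compContinuousLinearMap L = oneFormSymmL F (oneFormL E a ∘L L) := by
  refine oneForm_ext fun v ↦ ?_
  rw [oneFormSymmL_apply, ContinuousLinearMap.comp_apply, oneFormL_apply]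
  refine congrArg a ?_
  ext i; fin_cases i; rfl

/-- Smoothness of a 1-form can be tested on its pullback by a surjective submersion. -/
theorem IsOrbitSpace.smooth_of_pullback (hπ : IsOrbitSpace (F := F) D π) {η : DForm F C 1}
    (hη : (DForm.pullback (E := E) π η).Smooth) : η.Smooth := by
  intro c₀ z hz
  refine ContDiffAt.contDiffWithinAt ?_
  obtain ⟨m, hm⟩ := hπ.surjective ((extChartAt 𝓘(ℝ, F) c₀).symm z)
  obtain ⟨σ, hσ, h0, hs⟩ := hπ.exists_section m
  rw [hm] at hσ h0 hs
  have hsrc : ∀ᶠ w in 𝓝 z, σ ((extChartAt 𝓘(ℝ, F) c₀).symm w) ∈ (extChartAt 𝓘(ℝ, E) m).source := by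
    refine eventually_extChartAt_symm hz (p := fun c ↦ σ c ∈ _) (hσ.continuousAt.eventually ?_)
    rw [h0]
    exact extChartAt_source_mem_nhds m
  have hσd : ∀ᶠ c in 𝓝 ((extChartAt 𝓘(ℝ, F) c₀).symm z),
      MDifferentiableAt 𝓘(ℝ, F) 𝓘(ℝ, E) σ c := by
    have h1 : ContMDiffAt 𝓘(ℝ, F) 𝓘(ℝ, E) 1 σ _ := hσ.of_le (by simp)
    filter_upwards [(contMDiffAt_iff_contMDiffAt_nhds (by simp)).1 h1] with c hc
    exact hc.mdifferentiableAt (by simp)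
  -- `σ^* π^* η = η`, so the coordinates of `η` are those of `π^* η` pulled back by `σ`.
  have hpull : ∀ᶠ c in 𝓝 ((extChartAt 𝓘(ℝ, F) c₀).symm z),
      DForm.pullback (E := F) σ (DForm.pullback (E := E) π η) c = η c := by
    filter_upwards [hσd, hs.eventually_nhds] with c hc hsc
    have hid : (fun c ↦ π (σ c)) =ᶠ[𝓝 c] id := hsc
    have h1 : HasMFDerivAt 𝓘(ℝ, E) 𝓘(ℝ, F) π (σ c) (mfderiv 𝓘(ℝ, E) 𝓘(ℝ, F) π (σ c)) :=
      (hπ.smooth.mdifferentiableAt (by simp)).hasMFDerivAt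
    have h2 := h1.comp c hc.hasMFDerivAt
    have h3 := hasMFDerivAt_unique h2 ((hasMFDerivAt_id c).congr_of_eventuallyEq hid)
    refine oneForm_ext (E := F) fun v ↦ ?_
    have h4 : mfderiv 𝓘(ℝ, E) 𝓘(ℝ, F) π (σ c) (mfderiv 𝓘(ℝ, F) 𝓘(ℝ, E) σ c v) = v :=
      congrArg (fun T : F →L[ℝ] F ↦ T v) h3
    have h5 : ∀ (c' : C) (v' : F), c' = c → v' = v →
        (show F [⋀^Fin 1]→L[ℝ] ℝ from η c') ![v'] = (show F [⋀^Fin 1]→L[ℝ] ℝ from η c) ![v] := by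
      rintro c' v' rfl rfl; rfl
    refine Eq.trans ?_ (h5 _ _ hsc.self_of_nhds h4)
    refine congrArg (show F [⋀^Fin 1]→L[ℝ] ℝ from η (π (σ c))) ?_
    ext i; fin_cases i; rfl
  have hev : η.inChart c₀ =ᶠ[𝓝 z] fun w ↦
      oneFormSymmL F (oneFormL E ((DForm.pullback (E := E) π η).inChart m (chartRep F E σ c₀ m w))
        ∘L fderiv ℝ (chartRep F E σ c₀ m) w) := by
    filter_upwards [eventually_mem_target hz, hsrc, eventually_extChartAt_symm hz hσd,
      eventually_extChartAt_symm hz hpull] with w hw hw1 hw2 hw3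
    rw [← compContinuousLinearMap_oneForm, ← DForm.inChart_pullback _ hw hw1 hw2]
    rw [DForm.inChart, DForm.inChart, hw3]
  have hτ : ContDiffAt ℝ ∞ (chartRep F E σ c₀ m) z :=
    contDiffAt_chartRep hz hsrc.self_of_nhds hσ
  have hτz : chartRep F E σ c₀ m z = extChartAt 𝓘(ℝ, E) m m := by rw [chartRep, h0]
  have hα : ContDiffAt ℝ ∞ ((DForm.pullback (E := E) π η).inChart m) (chartRep F E σ c₀ m z) := by
    rw [hτz]
    exact (hη m).contDiffAt (extChartAt_target_mem_nhds m)
  have h1 : ContDiffAt ℝ ∞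
      (fun w ↦ (DForm.pullback (E := E) π η).inChart m (chartRep F E σ c₀ m w)) z :=
    hα.comp z hτ
  have h2 : ContDiffAt ℝ ∞ (fun w ↦ oneFormL E
      ((DForm.pullback (E := E) π η).inChart m (chartRep F E σ c₀ m w))) z :=
    contDiff_oneFormL.contDiffAt.comp z h1
  have h3 : ContDiffAt ℝ ∞ (fderiv ℝ (chartRep F E σ c₀ m)) z :=
    hτ.fderiv_right (by simp)
  exact (contDiff_oneFormSymmL.contDiffAt.comp z (h2.clm_comp h3)).congr_of_eventuallyEq hev

theorem DForm.smooth_smul_interior (hΩ : Ω.Smooth) (hD : D.SmoothOn Set.univ)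
    (hρ : IsScalingFunction D ρ) :
    DForm.Smooth (E := E) (k := 1) (fun m : M ↦ (ρ m)⁻¹ • Ω.interior D m) := by
  intro x₀ y hy
  refine ContDiffAt.contDiffWithinAt ?_
  have hev : DForm.inChart (E := E) (k := 1) (fun m : M ↦ (ρ m)⁻¹ • Ω.interior D m) x₀ =ᶠ[𝓝 y]
      fun z ↦ (ρ ((extChartAt 𝓘(ℝ, E) x₀).symm z))⁻¹ •
        curryTwoL E (Ω.inChart x₀ z) (D.inChart x₀ z) := by
    filter_upwards [eventually_mem_target hy] with z hz
    exact DForm.inChart_smul_interior D Ω ρ hz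
  have h1 : ContDiffAt ℝ ∞ (fun z ↦ ρ ((extChartAt 𝓘(ℝ, E) x₀).symm z)) y :=
    (hρ.smooth.contMDiffAt.comp y (contMDiffAt_extChartAt_symm hy)).contDiffAt
  have h2 : ContDiffAt ℝ ∞ (fun z ↦ curryTwoL E (Ω.inChart x₀ z)) y :=
    contDiff_curryTwoL.contDiffAt.comp y
      ((hΩ x₀).contDiffAt ((isOpen_extChartAt_target x₀).mem_nhds hy))
  exact ((h1.inv (hρ.ne_zero _)).smul
    (h2.clm_apply (hD.contDiffAt_inChart hy univ_mem))).congr_of_eventuallyEq hev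

/-- The exterior derivative of `i_D Ω / ρ`. -/
theorem DForm.d_smul_interior (hΩ : IsSymplectic Ω) (hD : D.SmoothOn Set.univ)
    (hlie : ∀ x v, Ω.lieDeriv D x v = Ω x v) (hρ : IsScalingFunction D ρ) (m : M)
    (u v : E) :
    DForm.d (E := E) (k := 1) (fun m : M ↦ (ρ m)⁻¹ • Ω.interior D m) m ![u, v] =
      (ρ m)⁻¹ * Ω m ![u, v] - (ρ m)⁻¹ ^ 2 *
        (differential ρ m u * Ω m ![D m, v] - differential ρ m v * Ω m ![D m, u]) := by
  have hy := mem_extChartAt_target (I := 𝓘(ℝ, E)) m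
  have hys : (extChartAt 𝓘(ℝ, E) m).symm (extChartAt 𝓘(ℝ, E) m m) = m := extChartAt_to_inv m
  have hev : DForm.inChart (E := E) (k := 1) (fun m : M ↦ (ρ m)⁻¹ • Ω.interior D m) m
      =ᶠ[𝓝 (extChartAt 𝓘(ℝ, E) m m)]
      fun z ↦ (ρ ((extChartAt 𝓘(ℝ, E) m).symm z))⁻¹ •
        (Ω.inChart m z).curryLeft (D.inChart m z) := by
    filter_upwards [eventually_mem_target hy] with z hz
    exact DForm.inChart_smul_interior D Ω ρ hz
  have hρd : MDifferentiableAt 𝓘(ℝ, E) 𝓘(ℝ, ℝ) ρ m := hρ.smooth.mdifferentiableAt (by simp)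
  have h1 : ContDiffAt ℝ ∞ (fun z ↦ ρ ((extChartAt 𝓘(ℝ, E) m).symm z)) (extChartAt 𝓘(ℝ, E) m m) :=
    (hρ.smooth.contMDiffAt.comp _ (contMDiffAt_extChartAt_symm hy)).contDiffAt
  have h2 : ContDiffAt ℝ ∞ (Ω.inChart m) (extChartAt 𝓘(ℝ, E) m m) :=
    (hΩ.smooth m).contDiffAt (extChartAt_target_mem_nhds m)
  have h3 : ContDiffAt ℝ ∞ (D.inChart m) (extChartAt 𝓘(ℝ, E) m m) :=
    hD.contDiffAt_inChart hy univ_mem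
  have hcl : extDeriv (Ω.inChart m) (extChartAt 𝓘(ℝ, E) m m) = 0 :=
    (DForm.d_eq Ω m).symm.trans (congrFun hΩ.closed m)
  have key := extDeriv_smul_curryLeft (h2.differentiableAt (by simp))
    (h3.differentiableAt (by simp)) (h1.differentiableAt (by simp)) (hρ.ne_zero _) hcl
    (DForm.lieEqSelfAt hlie m) u v
  rw [← hev.extDeriv_eq, fderiv_comp_extChartAt_symm_self hρd, fderiv_comp_extChartAt_symm_self hρd,
    hys, DForm.inChart_self, VField.inChart_self] at key
  rw [DForm.d_eq]
  exact key

end Quotient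

/-! ### Linear algebra of the reduction at one point -/

section Pointwise

variable {E : Type*} [NormedAddCommGroup E] [NormedSpace ℝ E]
  {F : Type*} [NormedAddCommGroup F] [NormedSpace ℝ F]

/-- A non-degenerate 2-form identifies vectors with covectors. -/
theorem exists_flat_eq [FiniteDimensional ℝ E] {Ω : E [⋀^Fin 2]→L[ℝ] ℝ}
    (hΩ : ∀ u, (∀ v, Ω ![u, v] = 0) → u = 0) :
    ∃ e : E ≃L[ℝ] (E →L[ℝ] ℝ), (e : E →L[ℝ] E →L[ℝ] ℝ) = flatL E Ω := by
  have hinj : Function.Injective (flatL E Ω) := by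
    refine (injective_iff_map_eq_zero _).2 fun u hu ↦ hΩ u fun v ↦ ?_
    rw [← flatL_apply, hu, zero_apply]
  have hdim : Module.finrank ℝ E = Module.finrank ℝ (E →L[ℝ] ℝ) := by
    rw [← LinearEquiv.finrank_eq (LinearMap.toContinuousLinearMap (𝕜 := ℝ) (E := E) (F' := ℝ))]
    exact Subspace.dual_finrank_eq.symm
  let e := (LinearEquiv.ofInjectiveOfFinrankEq (flatL E Ω).toLinearMap hinj
    hdim).toContinuousLinearEquiv
  exact ⟨e, by ext u v; rfl⟩

/-- The situation at one point of the reduction: `Ω` is the symplectic form, `d` the scaling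
symmetry, `r` and `dr` the value and the differential of the scaling function, `p` the differential
of the projection, while `η` and `ζ` are the reduced 1-form and its exterior derivative. -/
structure IsPointReduction (Ω : E [⋀^Fin 2]→L[ℝ] ℝ) (d : E) (r : ℝ) (dr : E →L[ℝ] ℝ)
    (p : E →L[ℝ] F) (η : F [⋀^Fin 1]→L[ℝ] ℝ) (ζ : F [⋀^Fin 2]→L[ℝ] ℝ) : Prop where
  nondegenerate : ∀ u, (∀ v, Ω ![u, v] = 0) → u = 0
  ne_zero : r ≠ 0
  scaling : dr d = r
  surjective : Function.Surjective p
  map_d : p d = 0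
  form : ∀ u, η ![p u] = r⁻¹ * Ω ![d, u]
  form_d : ∀ u v, ζ ![p u, p v] = r⁻¹ * Ω ![u, v] -
    r⁻¹ ^ 2 * (dr u * Ω ![d, v] - dr v * Ω ![d, u])

namespace IsPointReduction

variable {Ω : E [⋀^Fin 2]→L[ℝ] ℝ} {d : E} {r : ℝ} {dr : E →L[ℝ] ℝ} {p : E →L[ℝ] F}
  {η : F [⋀^Fin 1]→L[ℝ] ℝ} {ζ : F [⋀^Fin 2]→L[ℝ] ℝ}

theorem form_ne_zero (h : IsPointReduction Ω d r dr p η ζ) : η ≠ 0 := by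
  intro h0
  have hd : d = 0 := h.nondegenerate d fun v ↦ by
    have := h.form v
    rw [h0] at this
    exact (mul_eq_zero.1 this.symm).resolve_left (inv_ne_zero h.ne_zero)
  have := h.scaling
  rw [hd, map_zero] at this
  exact h.ne_zero this.symm

/-- If `u` lifts a vector of `ker η` annihilated by `ζ` on `ker η`, then `Ω(u, ·)` vanishes on the
kernel of `Ω(d, ·)`; so `u` is a multiple of `d` and projects to zero. -/
theorem eq_zero (h : IsPointReduction Ω d r dr p η ζ) {x : F} (hx : η ![x] = 0)
    (hx' : ∀ y, η ![y] = 0 → ζ ![x, y] = 0) : x = 0 := by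
  obtain ⟨u, rfl⟩ := h.surjective x
  have hr := inv_ne_zero h.ne_zero
  rw [h.form] at hx
  have hu : Ω ![d, u] = 0 := (mul_eq_zero.1 hx).resolve_left hr
  have hker : (⨅ _ : Unit, LinearMap.ker (flatL E Ω d).toLinearMap) ≤
      LinearMap.ker (flatL E Ω u).toLinearMap := by
    rw [iInf_const]
    intro v hv
    have hv' : Ω ![d, v] = 0 := by rw [← flatL_apply]; exact hv
    have h1 := hx' (p v) (by rw [h.form, hv', mul_zero])
    rw [h.form_d, hv', hu] at h1
    have h2 : r⁻¹ * Ω ![u, v] = 0 := by linarith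
    have h3 := (mul_eq_zero.1 h2).resolve_left hr
    rw [← flatL_apply] at h3
    exact h3
  -- A covector vanishing on the kernel of another one is a multiple of it.
  have hspan := mem_span_of_iInf_ker_le_ker hker
  rw [Set.range_const] at hspan
  obtain ⟨c, hc⟩ := Submodule.mem_span_singleton.1 hspan
  have hud : u - c • d = 0 := h.nondegenerate _ fun v ↦ by
    have h4 := congrArg (fun L : E →ₗ[ℝ] ℝ ↦ L v) hc
    have h5 : c * flatL E Ω d v = flatL E Ω u v := h4
    rw [← flatL_apply, map_sub, map_smul]
    simp only [sub_apply, smul_apply, smul_eq_mul]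
    rw [h5, sub_self]
  rw [sub_eq_zero.1 hud, map_smul, h.map_d, smul_zero]

/-- The projection of the Hamiltonian vector of the scaling function is the Reeb vector. -/
theorem reeb (h : IsPointReduction Ω d r dr p η ζ) {a : E} (ha : ∀ v, Ω ![a, v] = -dr v) :
    (∀ y, ζ ![p a, y] = 0) ∧ η ![p a] = 1 := by
  have hr := h.ne_zero
  have hda : Ω ![d, a] = r := by rw [twoForm_swap, ha, h.scaling, neg_neg]
  have hra : dr a = 0 := by linarith [ha a, twoForm_self Ω a]
  constructor
  · intro y
    obtain ⟨v, rfl⟩ := h.surjective y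
    rw [h.form_d, ha, hra, hda]
    field_simp
    ring
  · rw [h.form, hda, inv_mul_cancel₀ hr]

/-- If `b` is the Hamiltonian vector of a function homogeneous of degree one, namely of `-r h`, then
its projection is the contact Hamiltonian vector of `h`. -/
theorem contactHamiltonian (h : IsPointReduction Ω d r dr p η ζ) {a b : E} {k : ℝ} {dk : F →L[ℝ] ℝ}
    (ha : ∀ v, Ω ![a, v] = -dr v) (hb : ∀ v, Ω ![b, v] = r * dk (p v) + k * dr v) :
    (∀ y, ζ ![p b, y] = dk y - dk (p a) * η ![y]) ∧ η ![p b] = -k := by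
  have hr := h.ne_zero
  have hdb : Ω ![d, b] = -(k * r) := by
    rw [twoForm_swap, hb, h.map_d, map_zero, h.scaling]; ring
  have hra : dr a = 0 := by linarith [ha a, twoForm_self Ω a]
  have hrb : dr b = r * dk (p a) := by
    have h1 := ha b
    rw [twoForm_swap, hb, hra] at h1
    linarith
  constructor
  · intro y
    obtain ⟨v, rfl⟩ := h.surjective y
    rw [h.form_d, h.form, hb, hdb, hrb]
    field_simp
    ring
  · rw [h.form, hdb]
    field_simp

end IsPointReduction

/-- A vector is determined by its pairing with `η` and by its pairing under `ζ` with `ker η`. -/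
theorem eq_of_contact_conditions {η : F [⋀^Fin 1]→L[ℝ] ℝ} {ζ : F [⋀^Fin 2]→L[ℝ] ℝ}
    (hnd : ∀ x, η ![x] = 0 → (∀ y, η ![y] = 0 → ζ ![x, y] = 0) → x = 0) {w w' : F}
    (h1 : η ![w] = η ![w']) (h2 : ∀ y, η ![y] = 0 → ζ ![w, y] = ζ ![w', y]) : w = w' := by
  refine sub_eq_zero.1 (hnd _ ?_ fun y hy ↦ ?_)
  · rw [← oneFormL_apply, map_sub, oneFormL_apply, oneFormL_apply, h1, sub_self]
  · rw [← flatL_apply, map_sub, sub_apply, flatL_apply, flatL_apply, h2 y hy, sub_self]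

end Pointwise

/-! ### Hamiltonian and contact Hamiltonian vector fields -/

section Contact

variable {E : Type*} [NormedAddCommGroup E] [NormedSpace ℝ E] [FiniteDimensional ℝ E]
  {M : Type*} [TopologicalSpace M] [T2Space M] [ChartedSpace E M] [IsManifold 𝓘(ℝ, E) ∞ M]
  {F : Type*} [NormedAddCommGroup F] [NormedSpace ℝ F] [FiniteDimensional ℝ F]
  {C : Type*} [TopologicalSpace C] [ChartedSpace F C] [IsManifold 𝓘(ℝ, F) ∞ C]
  {D : VField E M} {π : M → C} {ρ : M → ℝ} {Ω : DForm E M 2}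

theorem IsSymplectic.exists_vector (hΩ : IsSymplectic Ω) (m : M) (l : E →L[ℝ] ℝ) :
    ∃ a : TangentSpace 𝓘(ℝ, E) m, ∀ v, Ω m ![a, v] = l v := by
  obtain ⟨e, he⟩ := exists_flat_eq (E := E) (Ω := Ω m) (hΩ.nondegenerate m)
  refine ⟨e.symm l, fun v ↦ ?_⟩
  have h1 : flatL E (Ω m) (e.symm l) = l := by
    rw [← he]; exact e.apply_symm_apply l
  exact (flatL_apply (E := E) (Ω m) (e.symm l) v).symm.trans
    (congrArg (fun L : E →L[ℝ] ℝ ↦ L v) h1)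

/-- The symplectic dual of the differential of a smooth function is a smooth vector field, because
inversion of linear maps is smooth. -/
theorem IsSymplectic.contMDiffAt_of_eq_mfderiv (hΩ : IsSymplectic Ω) {f : M → ℝ} {X : VField E M}
    {m : M} (hf : ContMDiffAt 𝓘(ℝ, E) 𝓘(ℝ, ℝ) ∞ f m)
    (hX : ∀ q, ∀ v : TangentSpace 𝓘(ℝ, E) q, Ω q ![X q, v] = mfderiv 𝓘(ℝ, E) 𝓘(ℝ, ℝ) f q v) :
    ContMDiffAt 𝓘(ℝ, E) 𝓘(ℝ, E).tangent ∞
      (fun x ↦ (⟨x, X x⟩ : TangentBundle 𝓘(ℝ, E) M)) m := by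
  have := FiniteDimensional.complete ℝ E
  refine contMDiffAt_vField_of_contDiffAt_inChart ?_
  have hy := mem_extChartAt_target (I := 𝓘(ℝ, E)) m
  have hys : (extChartAt 𝓘(ℝ, E) m).symm (extChartAt 𝓘(ℝ, E) m m) = m := extChartAt_to_inv m
  have hΩc : ContDiffAt ℝ ∞ (fun z ↦ flatL E (Ω.inChart m z)) (extChartAt 𝓘(ℝ, E) m m) :=
    contDiff_flatL.contDiffAt.comp _ ((hΩ.smooth m).contDiffAt (extChartAt_target_mem_nhds m))
  obtain ⟨e, he⟩ := exists_flat_eq (E := E) (Ω := Ω m) (hΩ.nondegenerate m)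
  have he' : flatL E (Ω.inChart m (extChartAt 𝓘(ℝ, E) m m)) = e := by
    rw [he, DForm.inChart_self]
  have hf' : ContMDiffAt 𝓘(ℝ, E) 𝓘(ℝ, ℝ) ∞ f
      ((extChartAt 𝓘(ℝ, E) m).symm (extChartAt 𝓘(ℝ, E) m m)) := by rwa [hys]
  have hfc : ContDiffAt ℝ ∞ (fun z ↦ f ((extChartAt 𝓘(ℝ, E) m).symm z))
      (extChartAt 𝓘(ℝ, E) m m) := (hf'.comp _ (contMDiffAt_extChartAt_symm hy)).contDiffAt
  have hfd : ∀ᶠ q in 𝓝 ((extChartAt 𝓘(ℝ, E) m).symm (extChartAt 𝓘(ℝ, E) m m)),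
      MDifferentiableAt 𝓘(ℝ, E) 𝓘(ℝ, ℝ) f q := by
    have h1 : ContMDiffAt 𝓘(ℝ, E) 𝓘(ℝ, ℝ) 1 f _ := hf'.of_le (by simp)
    filter_upwards [(contMDiffAt_iff_contMDiffAt_nhds (by simp)).1 h1] with c hc
    exact hc.mdifferentiableAt (by simp)
  have hinv : ∀ᶠ z in 𝓝 (extChartAt 𝓘(ℝ, E) m m), flatL E (Ω.inChart m z) ∈
      Set.range ((↑) : (E ≃L[ℝ] (E →L[ℝ] ℝ)) → E →L[ℝ] E →L[ℝ] ℝ) :=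
    hΩc.continuousAt.eventually_mem (by rw [he']; exact ContinuousLinearEquiv.nhds _)
  have hI : ContDiffAt ℝ ∞ (fun z ↦ (flatL E (Ω.inChart m z)).inverse)
      (extChartAt 𝓘(ℝ, E) m m) :=
    ContDiffAt.comp _ (g := ContinuousLinearMap.inverse)
      (by rw [he']; exact contDiffAt_map_inverse _) hΩc
  have hdf : ContDiffAt ℝ ∞ (fderiv ℝ (fun z ↦ f ((extChartAt 𝓘(ℝ, E) m).symm z)))
      (extChartAt 𝓘(ℝ, E) m m) := hfc.fderiv_right (by simp)
  refine (hI.clm_apply hdf).congr_of_eventuallyEq ?_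
  filter_upwards [eventually_mem_target hy, eventually_extChartAt_symm hy hfd, hinv]
    with z hz hfz ⟨e', he'z⟩
  have h1 : flatL E (Ω.inChart m z) (X.inChart m z) =
      fderiv ℝ (fun z ↦ f ((extChartAt 𝓘(ℝ, E) m).symm z)) z := by
    ext w
    rw [flatL_apply, DForm.inChart_apply_inChart hz, hX]
    have h2 := (hfz.hasMFDerivAt.comp z
      (mdifferentiableAt_extChartAt_symm E hz).hasMFDerivAt).mfderiv
    rw [← mfderiv_eq_fderiv]
    exact (congrArg (fun L : E →L[ℝ] ℝ ↦ L w) h2).symm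
  rw [← h1, ← he'z, ContinuousLinearMap.inverse_equiv]
  exact (e'.symm_apply_apply _).symm

theorem DForm.oneForm_pullback_apply {η : DForm F C 1} (m : M) (u : TangentSpace 𝓘(ℝ, E) m) :
    DForm.pullback π η m ![u] = η (π m) ![mfderiv 𝓘(ℝ, E) 𝓘(ℝ, F) π m u] := by
  refine congrArg (show F [⋀^Fin 1]→L[ℝ] ℝ from η (π m)) ?_
  ext i; fin_cases i; rfl

/-- The reduced form `η` and its exterior derivative satisfy the pointwise relations of the
reduction; here `π^* dη = d (i_D Ω / ρ)`. -/
theorem IsOrbitSpace.isPointReduction (hπ : IsOrbitSpace (F := F) D π) (hΩ : IsSymplectic Ω)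
    (hD : D.SmoothOn Set.univ) (hlie : ∀ x v, Ω.lieDeriv D x v = Ω x v)
    (hρ : IsScalingFunction D ρ) {η : DForm F C 1}
    (hη : DForm.pullback π η = fun m ↦ (ρ m)⁻¹ • Ω.interior D m) (m : M) :
    IsPointReduction (E := E) (F := F) (Ω m) (D m) (ρ m) (differential ρ m)
      (mfderiv 𝓘(ℝ, E) 𝓘(ℝ, F) π m) (η (π m)) (η.d (π m)) where
  nondegenerate := hΩ.nondegenerate m
  ne_zero := hρ.ne_zero m
  scaling := hρ.scaling m
  surjective := hπ.submersion m
  map_d := hπ.mfderiv_vField hD m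
  form u := (DForm.oneForm_pullback_apply m u).symm.trans
    (congrArg (fun α : E [⋀^Fin 1]→L[ℝ] ℝ ↦ α ![u]) (congrFun hη m))
  form_d u v := by
    have hsm : η.Smooth := hπ.smooth_of_pullback (by
      rw [hη]; exact DForm.smooth_smul_interior hΩ.smooth hD hρ)
    have h1 := DForm.d_pullback (E := E) (η := η) m
      (((hsm (π m)).contDiffAt (extChartAt_target_mem_nhds (π m))).differentiableAt (by simp))
      hπ.smooth ![u, v]
    rw [hη] at h1
    have h2 := DForm.d_smul_interior hΩ hD hlie hρ m u v
    refine Eq.trans ?_ (h1.symm.trans h2)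
    refine congrArg (show F [⋀^Fin 2]→L[ℝ] ℝ from η.d (π m)) ?_
    ext i; fin_cases i <;> rfl

theorem IsOrbitSpace.isContactForm (hπ : IsOrbitSpace (F := F) D π) (hΩ : IsSymplectic Ω)
    (hD : D.SmoothOn Set.univ) (hlie : ∀ x v, Ω.lieDeriv D x v = Ω x v)
    (hρ : IsScalingFunction D ρ) {η : DForm F C 1}
    (hη : DForm.pullback π η = fun m ↦ (ρ m)⁻¹ • Ω.interior D m) : IsContactForm η where
  smooth := hπ.smooth_of_pullback (by
    rw [hη]; exact DForm.smooth_smul_interior hΩ.smooth hD hρ)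
  ne_zero := by
    intro x
    obtain ⟨m, rfl⟩ := hπ.surjective x
    exact (hπ.isPointReduction hΩ hD hlie hρ hη m).form_ne_zero
  nondegenerate := by
    intro x u hu huv
    obtain ⟨m, rfl⟩ := hπ.surjective x
    exact (hπ.isPointReduction hΩ hD hlie hρ hη m).eq_zero hu huv

/-- The defining equations of the contact Hamiltonian vector field of `h`, for a vector `w` at the
point `x`. -/
def IsContactHamiltonianVector (η : DForm F C 1) (h : C → ℝ) (x : C)
    (w : TangentSpace 𝓘(ℝ, F) x) : Prop :=
  (∃ r, IsReebVector η x r ∧ ∀ v : TangentSpace 𝓘(ℝ, F) x,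
    η.d x ![w, v] = differential h x v - differential h x r * η x ![v]) ∧ η x ![w] = -h x

theorem IsContactHamiltonianVector.unique {η : DForm F C 1} (hη : IsContactForm η) {h : C → ℝ}
    {x : C} {w w' : TangentSpace 𝓘(ℝ, F) x} (hw : IsContactHamiltonianVector η h x w)
    (hw' : IsContactHamiltonianVector η h x w') : w = w' := by
  obtain ⟨⟨r, -, h1⟩, h2⟩ := hw
  obtain ⟨⟨r', -, h1'⟩, h2'⟩ := hw'
  refine eq_of_contact_conditions (F := F) (η := η x) (ζ := η.d x) (hη.nondegenerate x)
    (h2.trans h2'.symm) fun y hy ↦ ?_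
  have e1 := h1 y
  have e2 := h1' y
  have hy' : η x ![(y : TangentSpace 𝓘(ℝ, F) x)] = 0 := hy
  rw [hy', mul_zero] at e1 e2
  exact e1.trans e2.symm

theorem mfderiv_mul_comp (hπ : IsOrbitSpace (F := F) D π) (hρ : IsScalingFunction D ρ) {h : C → ℝ}
    {m : M} (hh : MDifferentiableAt 𝓘(ℝ, F) 𝓘(ℝ, ℝ) h (π m)) (v : TangentSpace 𝓘(ℝ, E) m) :
    mfderiv 𝓘(ℝ, E) 𝓘(ℝ, ℝ) (fun q ↦ ρ q * h (π q)) m v =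
      ρ m * differential h (π m) (mfderiv 𝓘(ℝ, E) 𝓘(ℝ, F) π m v) +
        h (π m) * differential ρ m v := by
  have h1 := hh.hasMFDerivAt.comp m (hπ.smooth.mdifferentiableAt (x := m) (by simp)).hasMFDerivAt
  have h2 := (hρ.smooth.mdifferentiableAt (x := m) (by simp)).hasMFDerivAt
  have h3 := (h2.mul h1).mfderiv
  exact congrArg (fun L : E →L[ℝ] ℝ ↦ L v) h3

/-- A smooth function `h` on an open set has exactly one contact Hamiltonian vector field; it is the
projection of the Hamiltonian vector field of the function `-ρ π^*h`, which is homogeneous of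
degree one. -/
theorem IsOrbitSpace.exists_contactHamiltonian (hπ : IsOrbitSpace (F := F) D π)
    (hΩ : IsSymplectic Ω) (hD : D.SmoothOn Set.univ) (hlie : ∀ x v, Ω.lieDeriv D x v = Ω x v)
    (hρ : IsScalingFunction D ρ) {η : DForm F C 1}
    (hη : DForm.pullback π η = fun m ↦ (ρ m)⁻¹ • Ω.interior D m) {U : Set C} (hU : IsOpen U)
    {h : C → ℝ} (hh : ContMDiffOn 𝓘(ℝ, F) 𝓘(ℝ, ℝ) ∞ h U) :
    ∃ X : VField F C, (∀ Y, IsContactHamiltonianVFieldOn η h Y U ↔ Set.EqOn Y X U) ∧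
      ∀ m, π m ∈ U → ∀ u : TangentSpace 𝓘(ℝ, E) m,
        (∀ v, Ω m ![u, v] = mfderiv 𝓘(ℝ, E) 𝓘(ℝ, ℝ) (fun q ↦ ρ q * h (π q)) m v) →
        X (π m) = mfderiv 𝓘(ℝ, E) 𝓘(ℝ, F) π m u := by
  have hcf := hπ.isContactForm hΩ hD hlie hρ hη
  have hhd : ∀ m, π m ∈ U → ContMDiffAt 𝓘(ℝ, F) 𝓘(ℝ, ℝ) ∞ h (π m) :=
    fun m hm ↦ hh.contMDiffAt (hU.mem_nhds hm)
  have hproj : ∀ m, π m ∈ U → ∀ u : TangentSpace 𝓘(ℝ, E) m,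
      (∀ v, Ω m ![u, v] = mfderiv 𝓘(ℝ, E) 𝓘(ℝ, ℝ) (fun q ↦ ρ q * h (π q)) m v) →
      IsContactHamiltonianVector η h (π m) (mfderiv 𝓘(ℝ, E) 𝓘(ℝ, F) π m u) := by
    intro m hm u hu
    have hpt := hπ.isPointReduction hΩ hD hlie hρ hη m
    obtain ⟨a, ha⟩ := hΩ.exists_vector m (-(differential ρ m : E →L[ℝ] ℝ))
    have hu' : ∀ v, (Ω m : E [⋀^Fin 2]→L[ℝ] ℝ) ![u, v] = ρ m *
        (differential h (π m) : F →L[ℝ] ℝ) (mfderiv 𝓘(ℝ, E) 𝓘(ℝ, F) π m v) +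
          h (π m) * (differential ρ m : E →L[ℝ] ℝ) v := fun v ↦
      (hu v).trans (mfderiv_mul_comp hπ hρ ((hhd m hm).mdifferentiableAt (by simp)) v)
    have hc := hpt.contactHamiltonian ha hu'
    exact ⟨⟨_, hpt.reeb ha, hc.1⟩, hc.2⟩
  choose X hX using fun m ↦ hΩ.exists_vector m
    (mfderiv 𝓘(ℝ, E) 𝓘(ℝ, ℝ) (fun q ↦ ρ q * h (π q)) m)
  choose s hs using hπ.surjective
  -- The field at `c` is projected from an arbitrary point `s c` of the fibre; uniqueness of the
  -- contact Hamiltonian vector shows that every point of the fibre gives the same result.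
  let Y : VField F C := fun c ↦
    (show F from mfderiv 𝓘(ℝ, E) 𝓘(ℝ, F) π (s c) (X (s c)))
  have hYc : ∀ c ∈ U, IsContactHamiltonianVector η h c (Y c) := by
    intro c hc
    have h1 : ∀ (c' : C) (w : F), c' = c →
        IsContactHamiltonianVector η h c' w → IsContactHamiltonianVector η h c w := by
      rintro c' w rfl h; exact h
    exact h1 _ _ (hs c) (hproj (s c) (by rwa [hs c]) (X (s c)) (hX (s c)))
  have hYπ : ∀ m, π m ∈ U → ∀ u : TangentSpace 𝓘(ℝ, E) m,
      (∀ v, Ω m ![u, v] = mfderiv 𝓘(ℝ, E) 𝓘(ℝ, ℝ) (fun q ↦ ρ q * h (π q)) m v) →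
      Y (π m) = mfderiv 𝓘(ℝ, E) 𝓘(ℝ, F) π m u :=
    fun m hm u hu ↦ (hYc _ hm).unique hcf (hproj m hm u hu)
  have hYs : Y.SmoothOn U := by
    intro c hc
    obtain ⟨m, rfl⟩ := hπ.surjective c
    refine ContMDiffAt.contMDiffWithinAt (hπ.contMDiffAt_vField_of_projection (X := X) ?_ ?_)
    · refine hΩ.contMDiffAt_of_eq_mfderiv
        (hρ.smooth.contMDiffAt.mul ((hhd m hc).comp m hπ.smooth.contMDiffAt)) hX
    · filter_upwards [hπ.smooth.continuous.continuousAt.eventually (hU.mem_nhds hc)] with q hq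
      exact (hYπ q hq (X q) (hX q)).symm
  refine ⟨Y, fun Z ↦ ⟨fun hZ c hc ↦ ?_, fun hZ ↦ ?_⟩, hYπ⟩
  · exact IsContactHamiltonianVector.unique hcf ⟨hZ.interior_d c hc, hZ.interior c hc⟩ (hYc c hc)
  · refine ⟨hU, ?_, hh, fun c hc ↦ ?_, fun c hc ↦ ?_⟩
    · exact ContMDiffOn.congr hYs fun c hc ↦ by rw [hZ hc]
    · rw [hZ hc]; exact (hYc c hc).1
    · rw [hZ hc]; exact (hYc c hc).2

end Contact

/-! ### Real powers of numbers of any sign -/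

/-- On each half-line `realPow · a` is a constant sign times the power of the absolute value. -/
theorem exists_realPow_eq (x a : ℝ) :
    ∃ ε : ℝ, |ε| = 1 ∧ ∀ y, 0 < x * y → realPow y a = ε * |y| ^ a := by
  by_cases h : x < 0 ∧ ∃ q : ℚ, (q : ℝ) = a ∧ Odd q.num ∧ Odd q.den
  · refine ⟨-1, by simp, fun y hy ↦ ?_⟩
    have hy' : y < 0 := by nlinarith [h.1]
    rw [realPow, if_pos ⟨hy', h.2⟩, neg_one_mul]
  · refine ⟨1, by simp, fun y hy ↦ ?_⟩
    rw [realPow, if_neg, one_mul]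
    rintro ⟨hy', hq⟩
    exact h ⟨by nlinarith, hq⟩

theorem abs_realPow {x : ℝ} (hx : x ≠ 0) (a : ℝ) : |realPow x a| = |x| ^ a := by
  obtain ⟨ε, hε, h⟩ := exists_realPow_eq x a
  rw [h x (mul_self_pos.2 hx), abs_mul, hε, one_mul, abs_of_nonneg (by positivity)]

theorem realPow_ne_zero {x : ℝ} (hx : x ≠ 0) (a : ℝ) : realPow x a ≠ 0 := by
  rw [← abs_pos, abs_realPow hx]
  exact Real.rpow_pos_of_pos (abs_pos.2 hx) a

theorem eventually_mul_pos {x : ℝ} (hx : x ≠ 0) : ∀ᶠ y in 𝓝 x, 0 < x * y := by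
  have h : ContinuousAt (fun y ↦ x * y) x := by fun_prop
  exact h.eventually (lt_mem_nhds (mul_self_pos.2 hx))

theorem hasDerivAt_abs_rpow {x : ℝ} (hx : x ≠ 0) (a : ℝ) :
    HasDerivAt (fun y ↦ |y| ^ a) (a * |x| ^ a / x) x := by
  have h := (hasDerivAt_abs hx).rpow_const (p := a) (Or.inl (abs_ne_zero.2 hx))
  refine h.congr_deriv ?_
  rw [Real.rpow_sub_one (abs_ne_zero.2 hx)]
  rcases lt_or_gt_of_ne hx with h0 | h0
  · rw [abs_of_neg h0, sign_neg h0]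
    simp
    field_simp
  · rw [abs_of_pos h0, sign_pos h0]
    simp
    field_simp

theorem hasDerivAt_realPow {x : ℝ} (hx : x ≠ 0) (a : ℝ) :
    HasDerivAt (fun y ↦ realPow y a) (a * realPow x a / x) x := by
  obtain ⟨ε, -, h⟩ := exists_realPow_eq x a
  have h1 := ((hasDerivAt_abs_rpow hx a).const_mul ε).congr_of_eventuallyEq
    ((eventually_mul_pos hx).mono fun y hy ↦ h y hy)
  refine h1.congr_deriv ?_
  rw [h x (mul_self_pos.2 hx)]
  ring

theorem contDiffAt_abs_rpow {x : ℝ} (hx : x ≠ 0) (a : ℝ) :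
    ContDiffAt ℝ ∞ (fun y ↦ |y| ^ a) x :=
  (contDiffAt_abs hx).rpow_const_of_ne (abs_ne_zero.2 hx)

theorem contDiffAt_realPow {x : ℝ} (hx : x ≠ 0) (a : ℝ) :
    ContDiffAt ℝ ∞ (fun y ↦ realPow y a) x := by
  obtain ⟨ε, -, h⟩ := exists_realPow_eq x a
  exact (contDiffAt_const.mul (contDiffAt_abs_rpow hx a)).congr_of_eventuallyEq
    ((eventually_mul_pos hx).mono fun y hy ↦ h y hy)

section ReducedHamiltonian

variable {E : Type*} [NormedAddCommGroup E] [NormedSpace ℝ E] [FiniteDimensional ℝ E]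
  {M : Type*} [TopologicalSpace M] [T2Space M] [ChartedSpace E M] [IsManifold 𝓘(ℝ, E) ∞ M]
  {F : Type*} [NormedAddCommGroup F] [NormedSpace ℝ F] [FiniteDimensional ℝ F]
  {C : Type*} [TopologicalSpace C] [ChartedSpace F C] [IsManifold 𝓘(ℝ, F) ∞ C]
  {D : VField E M} {π : M → C} {ρ : M → ℝ} {Ω : DForm E M 2} {H : M → ℝ} {Λ : ℝ}
  {XH : VField E M}

/-! ### The reduced Hamiltonian and the projected line field -/

/-- `-H / ρ ^ Λ` is homogeneous of degree zero, so it descends to the orbit space. -/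
theorem IsOrbitSpace.exists_reduced_hamiltonian (hπ : IsOrbitSpace (F := F) D π)
    (hρ : IsScalingFunction D ρ) (hH : ContMDiff 𝓘(ℝ, E) 𝓘(ℝ, ℝ) ∞ H)
    (hDH : ∀ x, lieDerivFun D H x = Λ * H x) :
    ∃ H₀ : C → ℝ, ∀ m, H₀ (π m) = -H m / realPow (ρ m) Λ := by
  choose s hs using hπ.surjective
  refine ⟨fun c ↦ -H (s c) / realPow (ρ (s c)) Λ, fun m ↦ ?_⟩
  refine hπ.eq_of_hasDerivAt_zero (g := fun q ↦ -H q / realPow (ρ q) Λ) ?_ (hs (π m))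
  intro γ t hγ _
  have h1 := hasDerivAt_comp_integralCurve (hH.mdifferentiableAt (by simp)) hγ
  have h2 := hasDerivAt_comp_integralCurve (hρ.smooth.mdifferentiableAt (by simp)) hγ
  have e1 : mfderiv 𝓘(ℝ, E) 𝓘(ℝ, ℝ) H (γ t) (D (γ t)) = Λ * H (γ t) := hDH (γ t)
  have e2 : mfderiv 𝓘(ℝ, E) 𝓘(ℝ, ℝ) ρ (γ t) (D (γ t)) = ρ (γ t) := hρ.scaling (γ t)
  rw [e1] at h1
  rw [e2] at h2
  have hne := hρ.ne_zero (γ t)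
  have hN := realPow_ne_zero hne Λ
  have h3 : HasDerivAt (fun s ↦ realPow (ρ (γ s)) Λ)
      (Λ * realPow (ρ (γ t)) Λ / ρ (γ t) * ρ (γ t)) t :=
    HasDerivAt.comp (h₂ := fun y ↦ realPow y Λ) (h := fun s ↦ ρ (γ s)) t
      (hasDerivAt_realPow hne Λ) h2
  refine (h1.fun_neg.fun_div h3 hN).congr_deriv ?_
  field_simp
  ring

/-- If the differential of `ρ π^*h` is a nonzero multiple of `dH` at `m`, then the contact
Hamiltonian vector of `h` spans the projection of the Hamiltonian vector of `H` at `m`. -/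
theorem IsOrbitSpace.span_projection_eq {h : C → ℝ} {X : VField F C} {U : Set C}
    (hXH : IsHamiltonianVField Ω H XH)
    (hX : ∀ m, π m ∈ U → ∀ u : TangentSpace 𝓘(ℝ, E) m,
      (∀ v, Ω m ![u, v] = mfderiv 𝓘(ℝ, E) 𝓘(ℝ, ℝ) (fun q ↦ ρ q * h (π q)) m v) →
      X (π m) = mfderiv 𝓘(ℝ, E) 𝓘(ℝ, F) π m u) {m : M} (hm : π m ∈ U) {k : ℝ} (hk : k ≠ 0)
    (hkH : ∀ v : TangentSpace 𝓘(ℝ, E) m,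
      mfderiv 𝓘(ℝ, E) 𝓘(ℝ, ℝ) (fun q ↦ ρ q * h (π q)) m v = k * differential H m v) :
    Submodule.span ℝ {X (π m)} =
      (Submodule.span ℝ {XH m}).map (mfderiv 𝓘(ℝ, E) 𝓘(ℝ, F) π m).toLinearMap := by
  have h1 : X (π m) = mfderiv 𝓘(ℝ, E) 𝓘(ℝ, F) π m ((-k) • XH m) := by
    refine hX m hm _ fun v ↦ ?_
    rw [hkH]
    refine (twoForm_smul_left (E := E) (Ω m) (-k) (XH m) v).trans ?_
    refine (congrArg (-k * ·) (hXH m v)).trans ?_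
    ring
  rw [h1, map_smul, Submodule.span_singleton_smul_eq (neg_ne_zero.2 hk).isUnit,
    Submodule.map_span, Set.image_singleton]
  rfl

end ReducedHamiltonian

end ScalingReduction

open ScalingReduction in
theorem mainTheorem1 (n : ℕ)
    {M : Type*} [TopologicalSpace M] [T2Space M] [SecondCountableTopology M]
    [ChartedSpace (EuclideanSpace ℝ (Fin (2 * n + 2))) M] [IsManifold (𝓡 (2 * n + 2)) ∞ M]
    {C : Type*} [TopologicalSpace C] [T2Space C] [SecondCountableTopology C]
    [ChartedSpace (EuclideanSpace ℝ (Fin (2 * n + 1))) C] [IsManifold (𝓡 (2 * n + 1)) ∞ C]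
    (Ω : DForm (EuclideanSpace ℝ (Fin (2 * n + 2))) M 2) (hΩ : IsSymplectic Ω)
    (H : M → ℝ) (hH : ContMDiff (𝓡 (2 * n + 2)) 𝓘(ℝ, ℝ) ∞ H)
    (XH : VField (EuclideanSpace ℝ (Fin (2 * n + 2))) M) (hXH : IsHamiltonianVField Ω H XH)
    (Λ : ℝ) (hΛ : Λ ≠ 0)
    (D : VField (EuclideanSpace ℝ (Fin (2 * n + 2))) M) (hD : IsScalingSymmetry Ω H Λ D)
    (π : M → C) (hπ : IsOrbitSpace (F := EuclideanSpace ℝ (Fin (2 * n + 1))) D π)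
    (ρ : M → ℝ) (hρ : IsScalingFunction D ρ) :
    ∃ η : DForm (EuclideanSpace ℝ (Fin (2 * n + 1))) C 1,
      -- the unique form with `π^* η = λ / ρ`, where `λ = i_D Ω`; it is a contact form
      (∀ η' : DForm (EuclideanSpace ℝ (Fin (2 * n + 1))) C 1,
        DForm.pullback π η' = (fun m ↦ (ρ m)⁻¹ • Ω.interior D m) ↔ η' = η) ∧
      IsContactForm η ∧
      ∃ H₀ : C → ℝ,
        -- the unique function with `π^* H₀ = -H / ρ ^ Λ`
        (∀ H' : C → ℝ, (∀ m, H' (π m) = -H m / realPow (ρ m) Λ) ↔ H' = H₀) ∧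
        -- (i)
        (∃ X₀ : VField (EuclideanSpace ℝ (Fin (2 * n + 1))) C,
          (∀ Y, IsContactHamiltonianVFieldOn η H₀ Y Set.univ ↔ Y = X₀) ∧
          SpansProjectionOn π XH X₀ (π '' {m | H m = 0})) ∧
        -- (ii)
        (∃ X₁ : VField (EuclideanSpace ℝ (Fin (2 * n + 1))) C,
          (∀ Y, IsContactHamiltonianVFieldOn η (fun x ↦ -|H₀ x| ^ (1 / Λ)) Y
              (π '' {m | H m = 0})ᶜ ↔ Set.EqOn Y X₁ (π '' {m | H m = 0})ᶜ) ∧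
          SpansProjectionOn π XH X₁ (π '' {m | H m = 0})ᶜ) := by
  have hdim : Module.finrank ℝ (EuclideanSpace ℝ (Fin (2 * n + 2))) =
      Module.finrank ℝ (EuclideanSpace ℝ (Fin (2 * n + 1))) + 1 := by simp
  obtain ⟨η, hη⟩ := hπ.exists_pullback_eq hΩ.smooth hD.smooth hD.form hρ hdim
  obtain ⟨H₀, hH₀⟩ := hπ.exists_reduced_hamiltonian hρ hH hD.hamiltonian
  have hzero : ∀ m, H₀ (π m) = 0 ↔ H m = 0 := by
    intro m
    rw [hH₀, div_eq_zero_iff, neg_eq_zero, or_iff_left (realPow_ne_zero (hρ.ne_zero m) Λ)]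
  have hmem : ∀ c, c ∈ π '' {m | H m = 0} ↔ H₀ c = 0 := by
    intro c
    constructor
    · rintro ⟨m, hm, rfl⟩
      exact (hzero m).2 hm
    · intro hc
      obtain ⟨m, rfl⟩ := hπ.surjective c
      exact ⟨m, (hzero m).1 hc, rfl⟩
  have hpow : ∀ m, ContMDiffAt (𝓡 (2 * n + 2)) 𝓘(ℝ, ℝ) ∞ (fun q ↦ (realPow (ρ q) Λ)⁻¹) m := by
    intro m
    have h1 : ContDiffAt ℝ ∞ (fun y ↦ (realPow y Λ)⁻¹) (ρ m) :=
      (contDiffAt_realPow (hρ.ne_zero m) Λ).inv (realPow_ne_zero (hρ.ne_zero m) Λ)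
    exact h1.contMDiffAt.comp m hρ.smooth.contMDiffAt
  have hH₀s : ContMDiff (𝓡 (2 * n + 1)) 𝓘(ℝ, ℝ) ∞ H₀ := by
    intro c
    obtain ⟨m, rfl⟩ := hπ.surjective c
    refine hπ.contMDiffAt_of_comp ?_
    refine ((hH.contMDiffAt (x := m)).neg.mul (hpow m)).congr_of_eventuallyEq
      (Filter.Eventually.of_forall fun q ↦ ?_)
    exact (hH₀ q).trans (div_eq_mul_inv _ _)
  have hopen : IsOpen (π '' {m | H m = 0})ᶜ := by
    have : (π '' {m | H m = 0})ᶜ = H₀ ⁻¹' {0}ᶜ := by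
      ext c
      rw [Set.mem_compl_iff, hmem]; rfl
    rw [this]
    exact isOpen_compl_singleton.preimage hH₀s.continuous
  have hHs : ContMDiffOn (𝓡 (2 * n + 1)) 𝓘(ℝ, ℝ) ∞ (fun x ↦ -|H₀ x| ^ (1 / Λ))
      (π '' {m | H m = 0})ᶜ := by
    intro c hc
    rw [Set.mem_compl_iff, hmem] at hc
    exact (((contDiffAt_abs_rpow hc (1 / Λ)).neg.contMDiffAt).comp c
      (hH₀s c)).contMDiffWithinAt
  obtain ⟨X₀, hX₀, hX₀'⟩ := hπ.exists_contactHamiltonian hΩ hD.smooth hD.form hρ hη isOpen_univ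
    hH₀s.contMDiffOn
  obtain ⟨X₁, hX₁, hX₁'⟩ := hπ.exists_contactHamiltonian hΩ hD.smooth hD.form hρ hη hopen hHs
  refine ⟨η, fun η' ↦ ⟨fun h ↦ hπ.pullback_injective (h.trans hη.symm), fun h ↦ h ▸ hη⟩,
    hπ.isContactForm hΩ hD.smooth hD.form hρ hη, H₀, fun H' ↦ ⟨fun h ↦ ?_, fun h ↦ h ▸ hH₀⟩,
    ⟨X₀, fun Y ↦ (hX₀ Y).trans (Set.eqOn_univ Y X₀), ?_⟩, ⟨X₁, hX₁, ?_⟩⟩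
  · funext c
    obtain ⟨m, rfl⟩ := hπ.surjective c
    rw [h, hH₀]
  · intro m hm
    have hm0 : H m = 0 := (hzero m).1 ((hmem _).1 hm)
    -- `ρ π^*H₀ = -(ρ / ρ ^ Λ) H`, and only the derivative of `H` survives where `H = 0`.
    refine IsOrbitSpace.span_projection_eq hXH hX₀' (Set.mem_univ _)
      (k := -(ρ m * (realPow (ρ m) Λ)⁻¹))
      (neg_ne_zero.2 (mul_ne_zero (hρ.ne_zero m) (inv_ne_zero (realPow_ne_zero (hρ.ne_zero m) Λ))))
      fun v ↦ ?_
    have e : (fun q ↦ ρ q * H₀ (π q)) = (fun q ↦ -(ρ q * (realPow (ρ q) Λ)⁻¹)) * H := by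
      funext q
      rw [hH₀, Pi.mul_apply]
      ring
    have hk : ContMDiffAt (𝓡 (2 * n + 2)) 𝓘(ℝ, ℝ) ∞ (fun q ↦ -(ρ q * (realPow (ρ q) Λ)⁻¹)) m :=
      (hρ.smooth.contMDiffAt.mul (hpow m)).neg
    have h1 := ((hk.mdifferentiableAt (by simp)).hasMFDerivAt.mul
      (hH.mdifferentiableAt (x := m) (by simp)).hasMFDerivAt).mfderiv
    have h2 : mfderiv (𝓡 (2 * n + 2)) 𝓘(ℝ, ℝ)
        ((fun q ↦ -(ρ q * (realPow (ρ q) Λ)⁻¹)) * H) m v =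
        -(ρ m * (realPow (ρ m) Λ)⁻¹) * differential H m v + H m *
          differential (fun q ↦ -(ρ q * (realPow (ρ q) Λ)⁻¹)) m v :=
      congrArg (fun L : EuclideanSpace ℝ (Fin (2 * n + 2)) →L[ℝ] ℝ ↦ L v) h1
    rw [hm0, zero_mul, add_zero] at h2
    rw [e]
    exact h2
  · intro m hm
    have hm0 : H m ≠ 0 := fun h ↦ hm ((hmem _).2 ((hzero m).2 h))
    -- `ρ π^*(-|H₀| ^ (1 / Λ)) = -(ρ / |ρ|) |H| ^ (1 / Λ)`, where `ρ / |ρ|` is locally constant.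
    refine IsOrbitSpace.span_projection_eq (h := fun x ↦ -|H₀ x| ^ (1 / Λ)) hXH hX₁' hm
      (k := -(ρ m / |ρ m|) * (1 / Λ * |H m| ^ (1 / Λ) / H m)) ?_ fun v ↦ ?_
    · have h1 := (Real.rpow_pos_of_pos (abs_pos.2 hm0) (1 / Λ)).ne'
      have h2 := hρ.ne_zero m
      have h3 := abs_ne_zero.2 h2
      exact mul_ne_zero (neg_ne_zero.2 (div_ne_zero h2 h3))
        (div_ne_zero (mul_ne_zero (one_div_ne_zero hΛ) h1) hm0)
    have hev : (fun q ↦ ρ q * -|H₀ (π q)| ^ (1 / Λ)) =ᶠ[nhds m]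
        (fun x ↦ -(ρ m / |ρ m|) * |x| ^ (1 / Λ)) ∘ H := by
      filter_upwards [hρ.smooth.continuous.continuousAt.eventually
        (eventually_mul_pos (hρ.ne_zero m))] with q hq
      have hq0 := hρ.ne_zero q
      have hsgn : ρ m / |ρ m| = ρ q / |ρ q| := by
        rcases pos_and_pos_or_neg_and_neg_of_mul_pos hq with ⟨h1, h2⟩ | ⟨h1, h2⟩
        · rw [abs_of_pos h1, abs_of_pos h2, div_self h1.ne', div_self h2.ne']
        · rw [abs_of_neg h1, abs_of_neg h2, div_neg, div_neg, div_self h1.ne, div_self h2.ne]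
      rw [Function.comp_apply, hsgn, hH₀, abs_div, abs_neg, abs_realPow hq0,
        Real.div_rpow (abs_nonneg _) (by positivity), ← Real.rpow_mul (abs_nonneg _),
        mul_one_div_cancel hΛ, Real.rpow_one]
      ring
    have h1 : HasMFDerivAt 𝓘(ℝ, ℝ) 𝓘(ℝ, ℝ) (fun x ↦ -(ρ m / |ρ m|) * |x| ^ (1 / Λ)) (H m) _ :=
      ((hasDerivAt_abs_rpow hm0 (1 / Λ)).const_mul (-(ρ m / |ρ m|))).hasFDerivAt.hasMFDerivAt
    have h2 := (h1.comp m (hH.mdifferentiableAt (x := m) (by simp)).hasMFDerivAt).mfderiv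
    rw [hev.mfderiv_eq]
    refine (congrArg (fun L : EuclideanSpace ℝ (Fin (2 * n + 2)) →L[ℝ] ℝ ↦ L v) h2).trans ?_
    exact mul_comm _ _
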